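/- **Theorem 3.1.** For $r>0$ write $D_r=\{y\in\mathbb C:\ |y|<r\}$. Let $T_0,R_0,\rho_0>0$ and let $F(t,x,z_1,z_2)$ be a continuous complex-valued function on $[0,T_0]\times D_{R_0}\times D_{\rho_0}\times D_{\rho_0}$ that is holomorphic in $(x,z_1,z_2)$ for each fixed $t$ and satisfies $$F(0,x,0,0)=0,\qquad \frac{\partial F}{\partial z_2}(0,x,0,0)=0\qquad (x\in D_{R_0}).$$ Put $a(t,x)=F(t,x,0,0)$, $\lambda(t,x)=\frac{\partial F}{\partial z_1}(t,x,0,0)$, $b(t,x)=\frac{\partial F}{\partial z_2}(t,x,0,0)$, and let $R(t,x,z_1,z_2)=F-a-\lambda z_1-b z_2$ be the sum of the terms of degree at least $2$ of the Taylor series of $F$ in $(z_1,z_2)$. Consider the equation $$t\,\frac{\partial u}{\partial t}=a(t,x)+\lambda(t,x)u+b(t,x)\frac{\partial u}{\partial x}+R\Bigl(t,x,u,\frac{\partial u}{\partial x}\Bigr).\tag{2.1}$$ Let $\mu(t)$ be a weight function on $(0,T_0]$, that is, an increasing, continuous, positive function with $\int_0^{T_0}\mu(\tau)\,\frac{d\tau}{\tau}<\infty$.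 Let $\mu\in\mathbb R$ be a constant (unrelated to the function $\mu(t)$), and suppose that for some $A,B>0$ $$|a(t,x)|\le A\,t^{\mu}\ \text{ on }[0,T_0]\times D_{R_0},\qquad |b(t,x)|\le B\,\mu(t)\ \text{ on }(0,T_0]\times D_{R_0},\qquad 0<\operatorname{Re}\lambda(0,0)<\mu .$$ Then equation (2.1) has a unique solution $u(t,x)\in X_1^{(\mu)}$. Here the function classes are as follows. $X_0([0,T]\times D_R)$ is the set of continuous functions on $[0,T]\times D_R$ that are holomorphic in $x$ for each fixed $t$. $X_1([0,T]\times D_R)$ is the set of $u\in X_0([0,T]\times D_R)$ that are of class $C^1$ on $(0,T)\times D_R$ and for which $t\,\partial u/\partial t$ extends from $(0,T)\times D_R$ to an element of $X_0([0,T]\times D_R)$. For $d>0$, $X_1^d$ is the set of germs at $(0,0)$ of functions $u\in X_1([0,T]\times D_R)$, with some $T,R>0$, such that $\max\{|u|,|\partial u/\partial x|\}\le C\,t^d$ on $[0,T]\times D_R$ for some $C>0$; two functions define the same germ if they coincide on $[0,\varepsilon]\times D_\delta$ for some $\varepsilon,\delta>0$. Finally $X_1^{(\mu)}=\bigcap_{0<d<\mu}X_1^d$.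 A germ is a solution of (2.1) if it is represented by some $u\in X_1([0,T]\times D_R)$, $0<T\le T_0$, $0<R\le R_0$, with $|u|<\rho_0$ and $|\partial u/\partial x|<\rho_0$, satisfying (2.1) on $(0,T)\times D_R$. Existence and uniqueness are meant for germs. -/

import Mathlib

open Set Filter Topology Metric MeasureTheory

namespace BriotBouquet

/-- The assumptions on the right-hand side `F(t, x, z₁, z₂)`, written `F t (x, z₁, z₂)`, on
`Ω = [0,T₀] × D_{R₀} × D_{ρ₀} × D_{ρ₀}`, where `D_r` is the open disc of radius `r` about `0`
in the complex plane. -/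
structure IsAdmissible (T₀ R₀ ρ₀ : ℝ) (F : ℝ → ℂ × ℂ × ℂ → ℂ) : Prop where
  continuousOn : ContinuousOn (fun p : ℝ × (ℂ × ℂ × ℂ) => F p.1 p.2)
    (Icc 0 T₀ ×ˢ (ball 0 R₀ ×ˢ ball 0 ρ₀ ×ˢ ball 0 ρ₀))
  holomorphic : ∀ t ∈ Icc 0 T₀,
    DifferentiableOn ℂ (F t) (ball 0 R₀ ×ˢ ball 0 ρ₀ ×ˢ ball 0 ρ₀)
  vanish : ∀ x ∈ ball (0 : ℂ) R₀, F 0 (x, 0, 0) = 0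
  vanish_deriv : ∀ x ∈ ball (0 : ℂ) R₀, deriv (fun z₂ : ℂ => F 0 (x, 0, z₂)) 0 = 0

/-- `a(t,x) = F(t,x,0,0)`. -/
noncomputable def coeffA (F : ℝ → ℂ × ℂ × ℂ → ℂ) (t : ℝ) (x : ℂ) : ℂ := F t (x, 0, 0)

/-- `λ(t,x) = (∂F/∂z₁)(t,x,0,0)`. -/
noncomputable def coeffLambda (F : ℝ → ℂ × ℂ × ℂ → ℂ) (t : ℝ) (x : ℂ) : ℂ :=
  deriv (fun z₁ : ℂ => F t (x, z₁, 0)) 0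

/-- `b(t,x) = (∂F/∂z₂)(t,x,0,0)`. -/
noncomputable def coeffB (F : ℝ → ℂ × ℂ × ℂ → ℂ) (t : ℝ) (x : ℂ) : ℂ :=
  deriv (fun z₂ : ℂ => F t (x, 0, z₂)) 0

/-- `R(t,x,z₁,z₂)`: what remains of `F` after its Taylor terms of degree at most one in
`(z₁, z₂)` are removed, i.e. the sum of the Taylor terms of degree at least two (the Taylor
series converges to `F` on the bidisc since `F` is holomorphic there). -/
noncomputable def remainder (F : ℝ → ℂ × ℂ × ℂ → ℂ) (t : ℝ) (x z₁ z₂ : ℂ) : ℂ :=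
  F t (x, z₁, z₂) - (coeffA F t x + coeffLambda F t x * z₁ + coeffB F t x * z₂)

/-- A weight function on `(0,T₀]`: continuous, increasing, positive, with `μ(τ)/τ` integrable
on `(0,T₀]`. -/
structure IsWeight (T₀ : ℝ) (m : ℝ → ℝ) : Prop where
  continuousOn : ContinuousOn m (Ioc 0 T₀)
  monotoneOn : MonotoneOn m (Ioc 0 T₀)
  pos : ∀ t ∈ Ioc 0 T₀, 0 < m t
  integrableOn : IntegrableOn (fun τ => m τ / τ) (Ioc 0 T₀)

/-- `X₀([0,T] × D_R)`: continuous functions, holomorphic in `x` for each fixed `t`. -/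
def X0 (T R : ℝ) : Set (ℝ × ℂ → ℂ) :=
  {f | ContinuousOn f (Icc 0 T ×ˢ ball 0 R) ∧
    ∀ t ∈ Icc 0 T, DifferentiableOn ℂ (fun x => f (t, x)) (ball 0 R)}

/-- `X₁([0,T] × D_R)`: functions in `X₀` that are `C¹` on `(0,T) × D_R` and for which
`t ∂f/∂t` belongs to `X₀`, i.e. extends from `(0,T) × D_R` to a function `g` in `X₀`. -/
def X1 (T R : ℝ) : Set (ℝ × ℂ → ℂ) :=
  {f | f ∈ X0 T R ∧ ContDiffOn ℝ 1 f (Ioo 0 T ×ˢ ball 0 R) ∧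
    ∃ g ∈ X0 T R, ∀ t ∈ Ioo 0 T, ∀ x ∈ ball (0 : ℂ) R,
      g (t, x) = (t : ℂ) * deriv (fun s : ℝ => f (s, x)) t}

/-- `X₁^d([0,T] × D_R)`: those `u` in `X₁` with `max {|u|, |∂u/∂x|} ≤ C t^d` for some `C`. -/
def X1d (d T R : ℝ) : Set (ℝ × ℂ → ℂ) :=
  {u | u ∈ X1 T R ∧ ∃ C > 0, ∀ t ∈ Icc 0 T, ∀ x ∈ ball (0 : ℂ) R,
    max ‖u (t, x)‖ ‖deriv (fun y : ℂ => u (t, y)) x‖ ≤ C * t ^ d}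

/-- Germs at `(0,0)` of functions on `{t ≥ 0}`: two functions have the same germ iff they agree
on `[0,ε] × D_δ` for some `ε, δ > 0`. -/
abbrev FunGerm : Type := Germ (𝓝[≥] (0 : ℝ) ×ˢ 𝓝 (0 : ℂ)) ℂ

/-- The germ of a function. -/
noncomputable def toGerm (u : ℝ × ℂ → ℂ) : FunGerm := (u : Germ (𝓝[≥] (0 : ℝ) ×ˢ 𝓝 (0 : ℂ)) ℂ)

/-- `X₁^d`: the inductive limit of the `X₁^d([0,T] × D_R)` as `(T,R) → (0,0)`. -/
def X1germ (d : ℝ) : Set FunGerm :=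
  {g | ∃ T > 0, ∃ R > 0, ∃ u ∈ X1d d T R, toGerm u = g}

/-- `X₁^{(d)}`: the intersection of the `X₁^a` over `0 < a < d`. -/
def X1paren (d : ℝ) : Set FunGerm := ⋂ a ∈ Ioo 0 d, X1germ a

/-- `u`, of class `X₁` on `[0,T] × D_R` inside `[0,T₀] × D_{R₀}`, takes values with its
`x`-derivative in the domain of `F` and solves
`t ∂u/∂t = a(t,x) + λ(t,x) u + b(t,x) ∂u/∂x + R(t, x, u, ∂u/∂x)` on `(0,T) × D_R`. -/
structure IsSolutionOn (T₀ R₀ ρ₀ : ℝ) (F : ℝ → ℂ × ℂ × ℂ → ℂ) (T R : ℝ)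
    (u : ℝ × ℂ → ℂ) : Prop where
  time_le : T ≤ T₀
  radius_le : R ≤ R₀
  regular : u ∈ X1 T R
  mem_domain : ∀ t ∈ Ioo 0 T, ∀ x ∈ ball (0 : ℂ) R,
    u (t, x) ∈ ball 0 ρ₀ ∧ deriv (fun y : ℂ => u (t, y)) x ∈ ball 0 ρ₀
  equation : ∀ t ∈ Ioo 0 T, ∀ x ∈ ball (0 : ℂ) R,
    (t : ℂ) * deriv (fun s : ℝ => u (s, x)) t =
      coeffA F t x + coeffLambda F t x * u (t, x)
        + coeffB F t x * deriv (fun y : ℂ => u (t, y)) x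
        + remainder F t x (u (t, x)) (deriv (fun y : ℂ => u (t, y)) x)

/-- The germs of solutions of the equation. -/
def solutionGerms (T₀ R₀ ρ₀ : ℝ) (F : ℝ → ℂ × ℂ × ℂ → ℂ) : Set FunGerm :=
  {g | ∃ T > 0, ∃ R > 0, ∃ u, IsSolutionOn T₀ R₀ ρ₀ F T R u ∧ toGerm u = g}

end BriotBouquet

/-!
The equation is `t u_t = F(t, x, u, u_x)`. Put `λ = λ(0,0)` and fix `d` with `Re λ < d < μ`. The
solutions of `t y' = λ y + h` that decay like `t^d` are given by one integral operator, `eulerInt`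
(`eq_eulerInt`, `hasDerivAt_eulerInt`), so that the solutions of size `t^d` of the equation are the
fixed points of
`picard : u ↦ eulerInt λ (F(·, x, u, u_x) - λ u)`.

For arguments of size `t^d` the function `F - λ z₁` has a small Lipschitz constant in `z₁`, and its
Lipschitz constant in `z₂` is at most `W(t) / 64`, where `W(t)` is a combination of `m(t)` and
`t^d`; this follows from the Cauchy estimates (`IsAdmissible.exists_isContractive`). Since `W(t) / t` is
integrable, the discs of radius `r - Ψ(t)`, `Ψ(t) = ∫₀ᵗ W(τ) dτ/τ`, keep a positive radius for small
`t`, and on the cone that they sweep out the loss of the derivative `u_x` is compensated: if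
`|w| ≤ N t^d / δ`, with `δ = r - |x| - Ψ(t)`, then `|w_x| ≤ 4 N t^d / δ²` by Cauchy's estimate
(`norm_deriv_le_of_cone`), and `W(τ) / τ / δ²` is the `τ`-derivative of `1 / δ`
(`IsShrinkage.norm_eulerInt_le`). Hence `picard` contracts by the factor `1/8` in the norm
`sup |w| δ / t^d`, as long as the functions and their `x`-derivatives are at most `t^d`
(`IsContractive.norm_picard_sub_le`).

Uniqueness is immediate from this (`IsContractive.eq_of_solutions`). For existence the bound on the
`x`-derivatives of the successive approximations has to be kept: the increments decay like `8^{-k}`,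
while their derivatives lose only `4^k` on cones whose radii decrease by multiples of `2^{-k}`
(`IsContractive.iter_bounds`). The limit solves the equation on the cone of half radius. Solutions
obtained for different `d` have the same germ by uniqueness, so that this germ is of size `t^d` for
every `d < μ`.
-/

namespace BriotBouquet

/-! ### Holomorphic functions depending on a parameter -/

section

lemma norm_deriv_le_of_closedBall {f : ℂ → ℂ} {x : ℂ} {r C : ℝ} (hr : 0 < r)
    (hd : ∀ y ∈ closedBall x r, DifferentiableAt ℂ f y) (hC : ∀ y ∈ closedBall x r, ‖f y‖ ≤ C) :
    ‖deriv f x‖ ≤ C / r := by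
  refine Complex.norm_deriv_le_of_forall_mem_sphere_norm_le hr ?_
    fun z hz => hC z (sphere_subset_closedBall hz)
  refine DifferentiableOn.diffContOnCl fun y hy => ?_
  exact (hd y (closure_ball_subset_closedBall hy)).differentiableWithinAt

/-- The derivative of a jointly continuous function that is holomorphic in the second variable is
jointly continuous. -/
lemma continuousOn_deriv_of_parameter {X : Type*} [TopologicalSpace X] {S : Set X} {c : ℂ} {r : ℝ}
    {f : X → ℂ → ℂ} (hf : ContinuousOn (fun p : X × ℂ => f p.1 p.2) (S ×ˢ ball c r))
    (hd : ∀ a ∈ S, DifferentiableOn ℂ (f a) (ball c r)) :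
    ContinuousOn (fun p : X × ℂ => deriv (f p.1) p.2) (S ×ˢ ball c r) := by
  rintro ⟨a, x⟩ ⟨ha, hx⟩
  have ha : a ∈ S := ha
  have hx : x ∈ ball c r := hx
  obtain ⟨δ, hδ, hsub⟩ := Metric.isOpen_iff.1 isOpen_ball x hx
  have hball : ∀ y, dist y x < δ → DifferentiableAt ℂ (f a) y := fun y hy =>
    (hd a ha).differentiableAt (isOpen_ball.mem_nhds (hsub hy))
  have hcont : ContinuousAt (deriv (f a)) x :=
    (((hd a ha).deriv isOpen_ball).differentiableAt (isOpen_ball.mem_nhds hx)).continuousAt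
  rw [Metric.continuousWithinAt_iff']
  intro ε hε
  have hK : closedBall x (δ / 2) ⊆ ball c r := fun y hy =>
    hsub (lt_of_le_of_lt (mem_closedBall.1 hy) (by linarith))
  have hu : {p : ℂ × ℂ | dist p.1 p.2 < ε * δ / 16} ∈ uniformity ℂ :=
    Metric.dist_mem_uniformity (by positivity)
  obtain ⟨v, hv, hvu⟩ := (isCompact_closedBall x (δ / 2)).mem_uniformity_of_prod
    (f := f) (s := S) (hf.mono (prod_mono_right hK)) ha hu
  rw [nhdsWithin_prod_eq]
  have h1 : ∀ᶠ y in 𝓝[ball c r] x, dist y x < δ / 4 ∧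
      dist (deriv (f a) y) (deriv (f a) x) < ε / 2 :=
    mem_nhdsWithin_of_mem_nhds (Filter.Eventually.and (Metric.ball_mem_nhds x (by positivity))
      (Metric.tendsto_nhds.1 hcont (ε / 2) (by positivity)))
  have h2 : ∀ᶠ b in 𝓝[S] a, b ∈ v ∧ b ∈ S := (show ∀ᶠ b in 𝓝[S] a, b ∈ v from hv).and
    self_mem_nhdsWithin
  filter_upwards [h2.prod_mk h1] with ⟨b, y⟩ ⟨⟨hbv, hbS⟩, hyx, hyε⟩
  simp only at hbv hbS hyx hyε ⊢
  have hsph : closedBall y (δ / 4) ⊆ closedBall x (δ / 2) := fun z hz => by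
    have := dist_triangle z y x
    simp only [mem_closedBall] at hz ⊢
    linarith
  have hdb : ∀ z ∈ closedBall y (δ / 4), DifferentiableAt ℂ (f b) z := fun z hz =>
    (hd b hbS).differentiableAt (isOpen_ball.mem_nhds (hK (hsph hz)))
  have hda : ∀ z ∈ closedBall y (δ / 4), DifferentiableAt ℂ (f a) z := fun z hz =>
    (hd a ha).differentiableAt (isOpen_ball.mem_nhds (hK (hsph hz)))
  have hy : y ∈ closedBall y (δ / 4) := mem_closedBall_self (by positivity)
  have key : ‖deriv (fun z => f b z - f a z) y‖ ≤ (ε * δ / 16) / (δ / 4) := by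
    refine norm_deriv_le_of_closedBall (by positivity)
      (fun z hz => (hdb z hz).sub (hda z hz)) fun z hz => ?_
    have := hvu b hbv z (hsph hz)
    simp only [mem_ofPred_eq, dist_eq_norm] at this
    rw [norm_sub_rev] at this
    first | exact this.le | (rw [norm_sub_rev]; exact this.le)
  rw [deriv_fun_sub (hdb y hy) (hda y hy)] at key
  have e : (ε * δ / 16) / (δ / 4) = ε / 4 := by field_simp; norm_num
  rw [e, ← dist_eq_norm] at key
  have := dist_triangle (deriv (f b) y) (deriv (f a) y) (deriv (f a) x)
  linarith

lemma exists_ball_prod_subset {Ω : Set (ℝ × ℂ)} (hΩ : IsOpen Ω) {p : ℝ × ℂ} (hp : p ∈ Ω) :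
    ∃ r > 0, ball p.1 r ×ˢ ball p.2 r ⊆ Ω := by
  obtain ⟨r, hr, h⟩ := Metric.isOpen_iff.1 hΩ p hp
  exact ⟨r, hr, by rw [ball_prod_same]; exact h⟩

/-- A function `f(t,x)` on a subset `Ω` of `ℝ × ℂ` that is jointly continuous and holomorphic
in `x` near each point of `Ω`. The second condition is stated as differentiability at the points
of `Ω`, which is the same for the open sets `Ω` that occur. -/
structure HolomorphicIn (Ω : Set (ℝ × ℂ)) (f : ℝ → ℂ → ℂ) : Prop where
  continuousOn : ContinuousOn (fun p : ℝ × ℂ => f p.1 p.2) Ω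
  differentiableAt : ∀ p ∈ Ω, DifferentiableAt ℂ (f p.1) p.2

namespace HolomorphicIn

variable {Ω Ω' : Set (ℝ × ℂ)} {f g : ℝ → ℂ → ℂ}

lemma mono (hf : HolomorphicIn Ω f) (h : Ω' ⊆ Ω) : HolomorphicIn Ω' f :=
  ⟨hf.1.mono h, fun p hp => hf.2 p (h hp)⟩

lemma sub (hf : HolomorphicIn Ω f) (hg : HolomorphicIn Ω g) :
    HolomorphicIn Ω (fun t x => f t x - g t x) :=
  ⟨hf.1.sub hg.1, fun p hp => (hf.2 p hp).sub (hg.2 p hp)⟩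

lemma deriv (hΩ : IsOpen Ω) (hf : HolomorphicIn Ω f) :
    HolomorphicIn Ω (fun t x => deriv (f t) x) := by
  refine ⟨fun p hp => ?_, fun p hp => ?_⟩
  · obtain ⟨r, hr, h⟩ := exists_ball_prod_subset hΩ hp
    have hnhds : ball p.1 r ×ˢ ball p.2 r ∈ 𝓝 p :=
      prod_mem_nhds (ball_mem_nhds _ hr) (ball_mem_nhds _ hr)
    have := continuousOn_deriv_of_parameter (f := f) (hf.1.mono h) fun a ha x hx =>
      (hf.2 (a, x) (h ⟨ha, hx⟩)).differentiableWithinAt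
    exact (this.continuousAt hnhds).continuousWithinAt
  · obtain ⟨r, hr, h⟩ := exists_ball_prod_subset hΩ hp
    have : DifferentiableOn ℂ (f p.1) (ball p.2 r) := fun x hx =>
      (hf.2 (p.1, x) (h ⟨mem_ball_self hr, hx⟩)).differentiableWithinAt
    exact (this.deriv isOpen_ball).differentiableAt (ball_mem_nhds _ hr)

end HolomorphicIn

/-- The real-linear map `(s, y) ↦ s a + b y` depends continuously on `(a, b)`. -/
lemma continuous_coprod_toSpanSingleton :
    Continuous fun q : ℂ × ℂ => (ContinuousLinearMap.toSpanSingleton ℝ q.1).coprod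
      ((ContinuousLinearMap.toSpanSingleton ℂ q.2).restrictScalars ℝ) := by
  have h₁ : Continuous fun z : ℂ => ContinuousLinearMap.toSpanSingleton ℝ z :=
    (ContinuousLinearMap.toSpanSingletonCLE (𝕜 := ℝ) (E := ℂ)).continuous
  have h₂ : Continuous fun z : ℂ => ContinuousLinearMap.toSpanSingleton ℂ z :=
    (ContinuousLinearMap.toSpanSingletonCLE (𝕜 := ℂ) (E := ℂ)).continuous
  have h₃ : Continuous fun z : ℂ =>
      (ContinuousLinearMap.toSpanSingleton ℂ z).restrictScalars ℝ :=
    (ContinuousLinearMap.restrictScalarsL ℂ ℂ ℂ ℝ ℝ).continuous.comp h₂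
  exact (ContinuousLinearMap.coprodEquivL (𝕜 := ℝ) ℝ (E := ℝ) (F := ℂ) (G := ℂ)).continuous.comp
    ((h₁.comp continuous_fst).prodMk (h₃.comp continuous_snd))

/-- A jointly continuous function of `(t,x)`, holomorphic in `x`, with continuous `t`-derivative is
of class `C¹` in the real sense. -/
lemma HolomorphicIn.contDiffOn {Ω : Set (ℝ × ℂ)} {f f' : ℝ → ℂ → ℂ} (hΩ : IsOpen Ω)
    (hf : HolomorphicIn Ω f) (hf' : ContinuousOn (fun p : ℝ × ℂ => f' p.1 p.2) Ω)
    (hd : ∀ p ∈ Ω, HasDerivAt (fun s => f s p.2) (f' p.1 p.2) p.1) :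
    ContDiffOn ℝ 1 (fun p : ℝ × ℂ => f p.1 p.2) Ω := by
  let f₁ : ℝ → ℂ → ℝ →L[ℝ] ℂ := fun t x => ContinuousLinearMap.toSpanSingleton ℝ (f' t x)
  let f₂ : ℝ → ℂ → ℂ →L[ℝ] ℂ := fun t x =>
    (ContinuousLinearMap.toSpanSingleton ℂ (_root_.deriv (f t) x)).restrictScalars ℝ
  have h₁ : ContinuousOn (fun p : ℝ × ℂ => f₁ p.1 p.2) Ω :=
    (ContinuousLinearMap.toSpanSingletonCLE (𝕜 := ℝ) (E := ℂ)).continuous.comp_continuousOn hf'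
  have h₂ : ContinuousOn (fun p : ℝ × ℂ => f₂ p.1 p.2) Ω := by
    have h₃ : Continuous fun z : ℂ => ContinuousLinearMap.toSpanSingleton ℂ z :=
      (ContinuousLinearMap.toSpanSingletonCLE (𝕜 := ℂ) (E := ℂ)).continuous
    exact ((ContinuousLinearMap.restrictScalarsL ℂ ℂ ℂ ℝ ℝ).continuous.comp h₃).comp_continuousOn
      (hf.deriv hΩ).1
  have hfd : ∀ p ∈ Ω, HasFDerivAt (fun p : ℝ × ℂ => f p.1 p.2)
      ((f₁ p.1 p.2).coprod (f₂ p.1 p.2)) p := by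
    intro p hp
    have hev : ∀ᶠ v in 𝓝 p, v ∈ Ω := hΩ.mem_nhds hp
    exact (hasStrictFDerivAt_uncurry_coprod (𝕜 := ℝ) (u := p) (f := f) (f₁ := f₁) (f₂ := f₂)
      (hev.mono fun v hv => (hd v hv).hasFDerivAt)
      (hev.mono fun v hv => ((hf.2 v hv).hasDerivAt.hasFDerivAt.restrictScalars ℝ))
      (h₁.continuousAt (hΩ.mem_nhds hp)) (h₂.continuousAt (hΩ.mem_nhds hp))).hasFDerivAt
  have hc : ContinuousOn (fun p : ℝ × ℂ => (f₁ p.1 p.2).coprod (f₂ p.1 p.2)) Ω := by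
    have := continuous_coprod_toSpanSingleton.comp_continuousOn (hf'.prodMk (hf.deriv hΩ).1)
    simpa only [Function.comp_def] using this
  clear_value f₁ f₂
  intro p hp
  refine ContDiffAt.contDiffWithinAt ?_
  rw [contDiffAt_one_iff]
  exact ⟨fun p => (f₁ p.1 p.2).coprod (f₂ p.1 p.2), Ω, hΩ.mem_nhds hp, hc, hfd⟩

end

/-! ### The operator inverting `t ∂/∂t - λ` -/

section

/-- The solution operator `h ↦ ∫₀¹ s^{-λ-1} h(ts) ds` of `t y' = λ y + h` that selects the solution
decaying faster than `t^{Re λ}` at `t = 0`; the substitution `τ = ts` turns it into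
`t^λ ∫₀ᵗ τ^{-λ-1} h(τ) dτ`. -/
noncomputable def eulerInt (lam : ℂ) (h : ℝ → ℂ) (t : ℝ) : ℂ :=
  ∫ s in (0 : ℝ)..1, (s : ℂ) ^ (-lam - 1) * h (t * s)

variable {lam : ℂ} {T C d : ℝ}

/-- The integrand of `eulerInt`, for a function of size `τ^d`, is dominated by `s^{d - Re λ - 1}`,
which is integrable as soon as `Re λ < d`. -/
lemma norm_cpow_mul_le {s τ : ℝ} {t : ℝ} {z : ℂ} (hs : 0 < s) (ht : 0 ≤ t) (hτ : τ = t * s)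
    {c : ℝ} (hz : ‖z‖ ≤ c * τ ^ d) :
    ‖(s : ℂ) ^ (-lam - 1) * z‖ ≤ (c * t ^ d) * s ^ (d - lam.re - 1) := by
  subst hτ
  rw [norm_mul, Complex.norm_cpow_eq_rpow_re_of_pos hs]
  have e : d - lam.re - 1 = (-lam - 1).re + d := by simp; ring
  rw [e, Real.rpow_add hs]
  rw [Real.mul_rpow ht hs.le] at hz
  have := Real.rpow_pos_of_pos hs (-lam - 1).re
  calc s ^ (-lam - 1).re * ‖z‖ ≤ s ^ (-lam - 1).re * (c * (t ^ d * s ^ d)) := by gcongr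
    _ = _ := by ring

lemma intervalIntegrable_rpow_gap (hd : lam.re < d) (a b : ℝ) :
    IntervalIntegrable (fun s : ℝ => s ^ (d - lam.re - 1)) volume a b :=
  intervalIntegral.intervalIntegrable_rpow' (by linarith)

lemma mul_mem_Ioo {t s : ℝ} (ht : t ∈ Ioo 0 T) (hs : s ∈ Ioc (0 : ℝ) 1) : t * s ∈ Ioo 0 T :=
  ⟨mul_pos ht.1 hs.1, (mul_le_of_le_one_right ht.1.le hs.2).trans_lt ht.2⟩

lemma aestronglyMeasurable_eulerInt {h : ℝ → ℂ} {t : ℝ}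
    (hh : ∀ s ∈ Ioc (0 : ℝ) 1, ContinuousAt h (t * s)) :
    AEStronglyMeasurable (fun s : ℝ => (s : ℂ) ^ (-lam - 1) * h (t * s))
      (volume.restrict (Ioc 0 1)) := by
  refine ContinuousOn.aestronglyMeasurable (fun s hs => ?_) measurableSet_Ioc
  have h1 := Complex.continuousAt_ofReal_cpow_const s (-lam - 1) (Or.inr hs.1.ne')
  have h2 : ContinuousAt (fun s : ℝ => h (t * s)) s :=
    ContinuousAt.comp (f := fun s : ℝ => t * s) (g := h) (hh s hs) (by fun_prop)
  exact (h1.mul h2).continuousWithinAt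

lemma continuousAt_mul_of_mem {h : ℝ → ℂ} (hh : ContinuousOn h (Ioo 0 T)) {t : ℝ}
    (ht : t ∈ Ioo 0 T) : ∀ s ∈ Ioc (0 : ℝ) 1, ContinuousAt h (t * s) := fun _ hs =>
  hh.continuousAt (isOpen_Ioo.mem_nhds (mul_mem_Ioo ht hs))

lemma intervalIntegrable_eulerInt {h : ℝ → ℂ} (hd : lam.re < d) (hh : ContinuousOn h (Ioo 0 T))
    (hC : ∀ τ ∈ Ioo 0 T, ‖h τ‖ ≤ C * τ ^ d) {t : ℝ} (ht : t ∈ Ioo 0 T) :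
    IntervalIntegrable (fun s : ℝ => (s : ℂ) ^ (-lam - 1) * h (t * s)) volume 0 1 := by
  have hg : IntervalIntegrable (fun s : ℝ => (C * t ^ d) * s ^ (d - lam.re - 1)) volume 0 1 :=
    (intervalIntegrable_rpow_gap hd 0 1).const_mul _
  rw [intervalIntegrable_iff_integrableOn_Ioc_of_le zero_le_one] at hg ⊢
  refine Integrable.mono' hg (aestronglyMeasurable_eulerInt (continuousAt_mul_of_mem hh ht)) ?_
  filter_upwards [ae_restrict_mem measurableSet_Ioc] with s hs
  exact norm_cpow_mul_le hs.1 ht.1.le rfl (hC _ (mul_mem_Ioo ht hs))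

lemma integral_rpow_gap (hd : lam.re < d) :
    ∫ s in (0 : ℝ)..1, s ^ (d - lam.re - 1) = 1 / (d - lam.re) := by
  rw [integral_rpow (Or.inl (by linarith))]
  simp [Real.zero_rpow (show d - lam.re ≠ 0 by linarith)]

lemma eulerInt_sub {h k : ℝ → ℂ} (hd : lam.re < d) (hh : ContinuousOn h (Ioo 0 T))
    (hC : ∀ τ ∈ Ioo 0 T, ‖h τ‖ ≤ C * τ ^ d) (hk : ContinuousOn k (Ioo 0 T))
    (hC' : ∀ τ ∈ Ioo 0 T, ‖k τ‖ ≤ C * τ ^ d) {t : ℝ} (ht : t ∈ Ioo 0 T) :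
    eulerInt lam (fun τ => h τ - k τ) t = eulerInt lam h t - eulerInt lam k t := by
  unfold eulerInt
  rw [← intervalIntegral.integral_sub (intervalIntegrable_eulerInt hd hh hC ht)
    (intervalIntegrable_eulerInt hd hk hC' ht)]
  simp only [mul_sub]

/-- Variation of constants in the form `t^λ ∫₀ᵗ τ^{-λ-1} h(τ) dτ`. -/
lemma eulerInt_eq {h : ℝ → ℂ} {t : ℝ} (ht : 0 < t) :
    eulerInt lam h t = (t : ℂ) ^ lam * ∫ τ in (0 : ℝ)..t, (τ : ℂ) ^ (-lam - 1) * h τ := by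
  have ht' : (t : ℂ) ≠ 0 := by exact_mod_cast ht.ne'
  have h1 := intervalIntegral.integral_comp_mul_left (a := 0) (b := 1)
    (fun τ : ℝ => (τ : ℂ) ^ (-lam - 1) * h τ) ht.ne'
  rw [mul_zero, mul_one] at h1
  have h2 : ∫ s in (0 : ℝ)..1, ((t * s : ℝ) : ℂ) ^ (-lam - 1) * h (t * s) =
      (t : ℂ) ^ (-lam - 1) * eulerInt lam h t := by
    unfold eulerInt
    rw [← intervalIntegral.integral_const_mul]
    refine intervalIntegral.integral_congr fun s hs => ?_
    rw [uIcc_of_le zero_le_one] at hs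
    rw [Complex.ofReal_mul, Complex.mul_cpow_ofReal_nonneg ht.le hs.1, mul_assoc]
  rw [h2] at h1
  have h3 : ∫ τ in (0 : ℝ)..t, (τ : ℂ) ^ (-lam - 1) * h τ =
      (t : ℂ) * ((t : ℂ) ^ (-lam - 1) * eulerInt lam h t) := by
    rw [h1, Complex.real_smul, ← mul_assoc, ← Complex.ofReal_mul, mul_inv_cancel₀ ht.ne']
    simp
  have h4 : (t : ℂ) ^ lam * ((t : ℂ) * (t : ℂ) ^ (-lam - 1)) = 1 := by
    rw [show (t : ℂ) * (t : ℂ) ^ (-lam - 1) = (t : ℂ) ^ (1 + (-lam - 1)) by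
      rw [Complex.cpow_add _ _ ht', Complex.cpow_one], ← Complex.cpow_add _ _ ht']
    simp
  rw [h3, ← mul_assoc, ← mul_assoc, mul_assoc ((t : ℂ) ^ lam), h4, one_mul]

lemma hasDerivAt_eulerInt {h : ℝ → ℂ} (hd : lam.re < d) (hh : ContinuousOn h (Ioo 0 T))
    (hC : ∀ τ ∈ Ioo 0 T, ‖h τ‖ ≤ C * τ ^ d) {t : ℝ} (ht : t ∈ Ioo 0 T) :
    HasDerivAt (eulerInt lam h) ((lam * eulerInt lam h t + h t) / t) t := by
  have ht' : (t : ℂ) ≠ 0 := by exact_mod_cast ht.1.ne'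
  set k : ℝ → ℂ := fun τ => (τ : ℂ) ^ (-lam - 1) * h τ with hk
  have hkc : ContinuousOn k (Ioo 0 T) := fun s hs => by
    exact (Complex.continuousAt_ofReal_cpow_const s (-lam - 1)
      (Or.inr hs.1.ne')).continuousWithinAt.mul (hh s hs)
  have hki : IntervalIntegrable k volume 0 t := by
    have hg : IntervalIntegrable (fun s : ℝ => C * s ^ (d - lam.re - 1)) volume 0 t :=
      (intervalIntegrable_rpow_gap hd 0 t).const_mul _
    rw [intervalIntegrable_iff_integrableOn_Ioc_of_le ht.1.le] at hg ⊢
    have hsub : Ioc 0 t ⊆ Ioo 0 T := fun s hs => ⟨hs.1, hs.2.trans_lt ht.2⟩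
    refine Integrable.mono' hg ((hkc.mono hsub).aestronglyMeasurable measurableSet_Ioc) ?_
    filter_upwards [ae_restrict_mem measurableSet_Ioc] with s hs
    have := norm_cpow_mul_le (lam := lam) (t := 1) hs.1 zero_le_one (one_mul s).symm
      (hC _ (hsub hs))
    simpa [hk] using this
  have hmem : Ioo 0 T ∈ 𝓝 t := isOpen_Ioo.mem_nhds ht
  have h1 : HasDerivAt (fun u => ∫ τ in (0 : ℝ)..u, k τ) (k t) t :=
    intervalIntegral.integral_hasDerivAt_right hki
      (hkc.stronglyMeasurableAtFilter isOpen_Ioo t ht) (hkc.continuousAt hmem)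
  have h2 : HasDerivAt (fun u : ℝ => (u : ℂ) ^ lam) (lam * (t : ℂ) ^ (lam - 1)) t := by
    have := (hasDerivAt_id (t : ℂ)).cpow_const (c := lam) (Or.inl (by simpa using ht.1))
    simpa using this.comp_ofReal
  have h3 := h2.mul h1
  have h4 : eulerInt lam h =ᶠ[𝓝 t] fun u => (u : ℂ) ^ lam * ∫ τ in (0 : ℝ)..u, k τ := by
    filter_upwards [hmem] with u hu using eulerInt_eq hu.1
  refine (h3.congr_of_eventuallyEq h4).congr_deriv ?_
  rw [eulerInt_eq ht.1, Complex.cpow_sub _ _ ht', Complex.cpow_one, hk]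
  simp only
  have h5 : (t : ℂ) ^ lam * (t : ℂ) ^ (-lam - 1) = (t : ℂ)⁻¹ := by
    rw [← Complex.cpow_add _ _ ht', show lam + (-lam - 1) = -1 by ring, Complex.cpow_neg_one]
  rw [← mul_assoc ((t : ℂ) ^ lam), h5]
  field_simp

/-- A solution of `t y' = λ y + h` that decays faster than `t^{Re λ}` is given by the
solution operator. -/
lemma eq_eulerInt {y h : ℝ → ℂ} (hd : lam.re < d) (hh : ContinuousOn h (Ioo 0 T))
    (hC : ∀ τ ∈ Ioo 0 T, ‖h τ‖ ≤ C * τ ^ d)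
    (hy : ∀ τ ∈ Ioo 0 T, HasDerivAt y ((lam * y τ + h τ) / τ) τ)
    (hyC : ∀ τ ∈ Ioo 0 T, ‖y τ‖ ≤ C * τ ^ d) {t : ℝ} (ht : t ∈ Ioo 0 T) :
    y t = eulerInt lam h t := by
  have ht' : (t : ℂ) ≠ 0 := by exact_mod_cast ht.1.ne'
  -- the primitive `s ↦ s^{-λ} y(ts)` of the integrand, continued by `0` to `s = 0`
  set f : ℝ → ℂ := fun s => if s = 0 then 0 else (s : ℂ) ^ (-lam) * y (t * s) with hf
  have hder : ∀ s ∈ Ioc (0 : ℝ) 1,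
      HasDerivAt f ((s : ℂ) ^ (-lam - 1) * h (t * s)) s := by
    intro s hs
    have hs' : (s : ℂ) ≠ 0 := by exact_mod_cast hs.1.ne'
    have h1 : HasDerivAt (fun u : ℝ => (u : ℂ) ^ (-lam)) (-lam * (s : ℂ) ^ (-lam - 1)) s := by
      have := (hasDerivAt_id (s : ℂ)).cpow_const (c := -lam) (Or.inl (by simpa using hs.1))
      simpa using this.comp_ofReal
    have h2 : HasDerivAt (fun u : ℝ => y (t * u))
        (t • ((lam * y (t * s) + h (t * s)) / (t * s : ℝ))) s := by
      have := (hy _ (mul_mem_Ioo ht hs)).scomp s ((hasDerivAt_id s).const_mul t)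
      simpa [Function.comp_def] using this
    have h3 : f =ᶠ[𝓝 s] fun u => (u : ℂ) ^ (-lam) * y (t * u) := by
      filter_upwards [lt_mem_nhds hs.1] with u hu
      simp [hf, hu.ne']
    refine ((h1.mul h2).congr_of_eventuallyEq h3).congr_deriv ?_
    rw [Complex.real_smul, Complex.cpow_sub _ _ hs', Complex.cpow_one, Complex.ofReal_mul]
    field_simp
    ring
  have hcont : ContinuousOn f (Icc 0 1) := by
    intro s hs
    rcases hs.1.eq_or_lt with rfl | hpos
    · have hlim : Tendsto (fun s : ℝ => (C * t ^ d) * s ^ (d - lam.re)) (𝓝[Icc 0 1] 0) (𝓝 0) := by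
        have : ContinuousAt (fun s : ℝ => (C * t ^ d) * s ^ (d - lam.re)) 0 :=
          continuousAt_const.mul (Real.continuousAt_rpow_const _ _ (Or.inr (by linarith)))
        have h0 := this.tendsto
        rw [Real.zero_rpow (by linarith), mul_zero] at h0
        exact h0.mono_left nhdsWithin_le_nhds
      have h0 : f 0 = 0 := by simp [hf]
      rw [ContinuousWithinAt, h0]
      refine squeeze_zero_norm' ?_ hlim
      filter_upwards [self_mem_nhdsWithin] with s hs
      rcases hs.1.eq_or_lt with rfl | hpos
      · rw [h0, norm_zero, Real.zero_rpow (by linarith), mul_zero]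
      · have := norm_cpow_mul_le (lam := lam - 1) hpos ht.1.le rfl
          (hyC _ (mul_mem_Ioo ht ⟨hpos, hs.2⟩))
        rw [show -(lam - 1) - 1 = -lam by ring,
          show d - (lam - 1).re - 1 = d - lam.re by rw [Complex.sub_re, Complex.one_re]; ring]
          at this
        simpa only [hf, hpos.ne', if_false] using this
    · exact (hder s ⟨hpos, hs.2⟩).continuousAt.continuousWithinAt
  have := intervalIntegral.integral_eq_sub_of_hasDerivAt_of_le zero_le_one hcont
    (fun s hs => hder s ⟨hs.1, hs.2.le⟩) (intervalIntegrable_eulerInt hd hh hC ht)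
  rw [eulerInt, this]
  simp [hf]

/-- The solution operator preserves joint continuity and holomorphy in `x`. -/
lemma HolomorphicIn.eulerInt {Ω : Set (ℝ × ℂ)} {g : ℝ → ℂ → ℂ} (hΩ : IsOpen Ω)
    (hpos : ∀ p ∈ Ω, 0 < p.1) (hstar : ∀ p ∈ Ω, ∀ s ∈ Ioc (0 : ℝ) 1, (p.1 * s, p.2) ∈ Ω)
    (hd : lam.re < d) (hC0 : 0 ≤ C) (hg : HolomorphicIn Ω g)
    (hC : ∀ p ∈ Ω, ‖g p.1 p.2‖ ≤ C * p.1 ^ d) :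
    HolomorphicIn Ω (fun t x => eulerInt lam (fun τ => g τ x) t) := by
  have hmeas : ∀ {g : ℝ → ℂ → ℂ}, HolomorphicIn Ω g → ∀ p ∈ Ω, AEStronglyMeasurable
      (fun s : ℝ => (s : ℂ) ^ (-lam - 1) * g (p.1 * s) p.2) (volume.restrict (Ioc 0 1)) := by
    intro g hg p hp
    refine aestronglyMeasurable_eulerInt (h := fun τ => g τ p.2) fun s hs => ?_
    have h2 : ContinuousAt (fun q : ℝ × ℂ => g q.1 q.2) (p.1 * s, p.2) :=
      hg.1.continuousAt (hΩ.mem_nhds (hstar p hp s hs))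
    exact ContinuousAt.comp (f := fun τ : ℝ => (τ, p.2)) (g := fun q : ℝ × ℂ => g q.1 q.2) h2
      (by fun_prop)
  have hint : ∀ c : ℝ, Integrable (fun s : ℝ => c * s ^ (d - lam.re - 1))
      (volume.restrict (Ioc 0 1)) := fun c => by
    have := (intervalIntegrable_rpow_gap hd 0 1).const_mul c
    rwa [intervalIntegrable_iff_integrableOn_Ioc_of_le zero_le_one] at this
  refine ⟨fun p hp => ContinuousAt.continuousWithinAt ?_, fun p hp => ?_⟩
  · simp only [BriotBouquet.eulerInt, intervalIntegral.integral_of_le zero_le_one]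
    have hnear : ∀ᶠ q : ℝ × ℂ in 𝓝 p, q.1 ^ d ≤ p.1 ^ d + 1 := by
      have : ContinuousAt (fun q : ℝ × ℂ => q.1 ^ d) p :=
        (Real.continuousAt_rpow_const _ _ (Or.inl (hpos p hp).ne')).comp continuousAt_fst
      exact (this.eventually (gt_mem_nhds (lt_add_one _))).mono fun q hq => hq.le
    refine continuousAt_of_dominated
      (bound := fun s => (C * (p.1 ^ d + 1)) * s ^ (d - lam.re - 1)) ?_ ?_ (hint _) ?_
    · filter_upwards [hΩ.mem_nhds hp] with q hq using hmeas hg q hq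
    · filter_upwards [hΩ.mem_nhds hp, hnear] with q hq hq'
      filter_upwards [ae_restrict_mem measurableSet_Ioc] with s hs
      refine (norm_cpow_mul_le hs.1 (hpos q hq).le rfl (hC _ (hstar q hq s hs))).trans ?_
      have := Real.rpow_nonneg hs.1.le (d - lam.re - 1)
      gcongr
    · filter_upwards [ae_restrict_mem measurableSet_Ioc] with s hs
      have h2 : ContinuousAt (fun q : ℝ × ℂ => g q.1 q.2) (p.1 * s, p.2) :=
        hg.1.continuousAt (hΩ.mem_nhds (hstar p hp s hs))
      have h3 : ContinuousAt (fun q : ℝ × ℂ => g (q.1 * s) q.2) p :=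
        ContinuousAt.comp (f := fun q : ℝ × ℂ => (q.1 * s, q.2)) (g := fun q : ℝ × ℂ => g q.1 q.2)
          h2 (by fun_prop)
      exact continuousAt_const.mul h3
  · obtain ⟨r, hr, hsub⟩ := exists_ball_prod_subset hΩ hp
    have hmem : ∀ x ∈ ball p.2 r, (p.1, x) ∈ Ω := fun x hx => hsub ⟨mem_ball_self hr, hx⟩
    have hr2 : ∀ x ∈ ball p.2 (r / 2), closedBall x (r / 2) ⊆ ball p.2 r := by
      intro x hx y hy
      have := dist_triangle y x p.2
      simp only [mem_ball, mem_closedBall] at *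
      linarith
    have key := (hasDerivAt_integral_of_dominated_loc_of_deriv_le
      (μ := volume.restrict (Ioc (0 : ℝ) 1)) (𝕜 := ℂ) (x₀ := p.2) (s := ball p.2 (r / 2))
      (F := fun x s => (s : ℂ) ^ (-lam - 1) * g (p.1 * s) x)
      (F' := fun x s => (s : ℂ) ^ (-lam - 1) * _root_.deriv (g (p.1 * s)) x)
      (bound := fun s => (C / (r / 2) * p.1 ^ d) * s ^ (d - lam.re - 1))
      (ball_mem_nhds _ (by positivity)) ?_ ?_ (hmeas (hg.deriv hΩ) p hp) ?_ (hint _) ?_).2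
    · simp only [BriotBouquet.eulerInt, intervalIntegral.integral_of_le zero_le_one]
      exact key.differentiableAt
    · filter_upwards [ball_mem_nhds p.2 hr] with x hx using hmeas hg (p.1, x) (hmem x hx)
    · refine (hint (C * p.1 ^ d)).mono' (hmeas hg p hp) ?_
      filter_upwards [ae_restrict_mem measurableSet_Ioc] with s hs
      exact norm_cpow_mul_le hs.1 (hpos p hp).le rfl (hC _ (hstar p hp s hs))
    · filter_upwards [ae_restrict_mem measurableSet_Ioc] with s hs x hx
      refine norm_cpow_mul_le hs.1 (hpos p hp).le rfl ?_
      rw [div_mul_eq_mul_div]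
      exact norm_deriv_le_of_closedBall (by positivity)
        (fun y hy => hg.2 (p.1 * s, y) (hstar (p.1, y) (hmem y (hr2 x hx hy)) s hs))
        (fun y hy => hC (p.1 * s, y) (hstar (p.1, y) (hmem y (hr2 x hx hy)) s hs))
    · filter_upwards [ae_restrict_mem measurableSet_Ioc] with s hs x hx
      refine HasDerivAt.const_mul _ (DifferentiableAt.hasDerivAt ?_)
      exact hg.2 (p.1 * s, x)
        (hstar (p.1, x) (hmem x (ball_subset_ball (by linarith) hx)) s hs)

end

/-! ### Shrinking discs -/

section

/-- `Ψ(t) = ∫₀ᵗ W(τ) dτ/τ` with `W ≥ 0`, stated through the derivative of `Ψ`: the amount by which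
the radius of a disc has shrunk at time `t`. -/
structure IsShrinkage (T : ℝ) (W Ψ : ℝ → ℝ) : Prop where
  continuousOn : ContinuousOn Ψ (Ico 0 T)
  zero : Ψ 0 = 0
  nonneg : ∀ t ∈ Ioo 0 T, 0 ≤ W t
  hasDerivAt : ∀ t ∈ Ioo 0 T, HasDerivAt Ψ (W t / t) t

namespace IsShrinkage

variable {lam : ℂ} {T d : ℝ} {W Ψ : ℝ → ℝ}

lemma monotoneOn (h : IsShrinkage T W Ψ) : MonotoneOn Ψ (Ico 0 T) := by
  refine monotoneOn_of_deriv_nonneg (convex_Ico 0 T) h.continuousOn ?_ ?_ <;>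
    rw [interior_Ico] <;> intro t ht
  · exact (h.hasDerivAt t ht).differentiableAt.differentiableWithinAt
  · rw [(h.hasDerivAt t ht).deriv]
    exact div_nonneg (h.nonneg t ht) ht.1.le

lemma le_of_le (h : IsShrinkage T W Ψ) {s t : ℝ} (hs : 0 ≤ s) (hst : s ≤ t) (ht : t < T) :
    Ψ s ≤ Ψ t :=
  h.monotoneOn ⟨hs, hst.trans_lt ht⟩ ⟨hs.trans hst, ht⟩ hst

lemma psi_nonneg (h : IsShrinkage T W Ψ) {t : ℝ} (ht : t ∈ Ico 0 T) : 0 ≤ Ψ t :=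
  h.zero ▸ h.le_of_le le_rfl ht.1 ht.2

/-- The loss of one derivative, of size `W(τ) / (r - Ψ(τ))²`, is recovered by the integration
since `W(τ) / τ / (r - Ψ(τ))²` is the derivative of `1 / (r - Ψ(τ))`. -/
lemma norm_eulerInt_le (hW : IsShrinkage T W Ψ) (hd : lam.re < d) {h : ℝ → ℂ} {t r α β : ℝ}
    (ht : t ∈ Ioo 0 T) (hr : Ψ t < r) (hβ : 0 ≤ β)
    (hh : ∀ τ ∈ Ioc 0 t, ‖h τ‖ ≤ (α + β * (W τ / (r - Ψ τ) ^ 2)) * τ ^ d) :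
    ‖eulerInt lam h t‖ ≤ (α / (d - lam.re) + β / (r - Ψ t)) * t ^ d := by
  have hr0 : 0 < r := (hW.psi_nonneg ⟨ht.1.le, ht.2⟩).trans_lt hr
  have hle : ∀ s ∈ Icc (0 : ℝ) 1, 0 < r - Ψ (t * s) := fun s hs => by
    have := hW.le_of_le (mul_nonneg ht.1.le hs.1) (mul_le_of_le_one_right ht.1.le hs.2) ht.2
    linarith
  set f : ℝ → ℝ := fun s => (r - Ψ (t * s))⁻¹ with hf
  set f' : ℝ → ℝ := fun s => W (t * s) / s / (r - Ψ (t * s)) ^ 2 with hf'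
  have hder : ∀ s ∈ Ioo (0 : ℝ) 1, HasDerivAt f (f' s) s := by
    intro s hs
    have h1 := (hW.hasDerivAt _ (mul_mem_Ioo ht ⟨hs.1, hs.2.le⟩)).comp s
      ((hasDerivAt_id s).const_mul t)
    have h2 := (h1.const_sub r).inv (hle s ⟨hs.1.le, hs.2.le⟩).ne'
    refine h2.congr_deriv ?_
    have := hs.1.ne'
    have := ht.1.ne'
    simp only [hf', Function.comp_apply]
    field_simp
  have hcont : ContinuousOn f (Icc 0 1) := by
    refine ContinuousOn.inv₀ (continuousOn_const.sub ?_) fun s hs => (hle s hs).ne'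
    refine hW.continuousOn.comp (by fun_prop) fun s hs => ?_
    exact ⟨mul_nonneg ht.1.le hs.1, (mul_le_of_le_one_right ht.1.le hs.2).trans_lt ht.2⟩
  have hnn : ∀ s ∈ Ioc (0 : ℝ) 1, 0 ≤ f' s := fun s hs =>
    div_nonneg (div_nonneg (hW.nonneg _ (mul_mem_Ioo ht hs)) hs.1.le) (sq_nonneg _)
  have hint : IntervalIntegrable f' volume 0 1 := by
    rw [intervalIntegrable_iff_integrableOn_Ioc_of_le zero_le_one]
    exact intervalIntegral.integrableOn_deriv_of_nonneg hcont hder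
      fun s hs => hnn s ⟨hs.1, hs.2.le⟩
  have hval : ∫ s in (0 : ℝ)..1, f' s = (r - Ψ t)⁻¹ - r⁻¹ := by
    rw [intervalIntegral.integral_eq_sub_of_hasDerivAt_of_le zero_le_one hcont hder hint]
    simp [hf, hW.zero]
  have hpw := intervalIntegrable_rpow_gap hd 0 1
  have hbint : IntervalIntegrable
      (fun s => t ^ d * (α * s ^ (d - lam.re - 1) + β * f' s)) volume 0 1 :=
    ((hpw.const_mul α).add (hint.const_mul β)).const_mul _
  have hbd : ‖eulerInt lam h t‖ ≤
      ∫ s in (0 : ℝ)..1, t ^ d * (α * s ^ (d - lam.re - 1) + β * f' s) := by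
    refine intervalIntegral.norm_integral_le_of_norm_le zero_le_one ?_ hbint
    refine Eventually.of_forall fun s hs => ?_
    refine (norm_cpow_mul_le hs.1 ht.1.le rfl (hh _ ⟨mul_pos ht.1 hs.1,
      mul_le_of_le_one_right ht.1.le hs.2⟩)).trans ?_
    have e : s ^ (d - lam.re - 1) * (W (t * s) / (r - Ψ (t * s)) ^ 2) =
        s ^ (d - lam.re) * f' s := by
      rw [Real.rpow_sub_one hs.1.ne']
      simp only [hf']
      ring
    have h1 : s ^ (d - lam.re) * f' s ≤ f' s :=
      mul_le_of_le_one_left (hnn s hs) (Real.rpow_le_one hs.1.le hs.2 (by linarith))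
    have htd := Real.rpow_nonneg ht.1.le d
    calc _ = t ^ d * (α * s ^ (d - lam.re - 1) +
          β * (s ^ (d - lam.re - 1) * (W (t * s) / (r - Ψ (t * s)) ^ 2))) := by ring
      _ ≤ _ := by rw [e]; gcongr
  rw [intervalIntegral.integral_const_mul, intervalIntegral.integral_add (hpw.const_mul α)
    (hint.const_mul β), intervalIntegral.integral_const_mul, intervalIntegral.integral_const_mul,
    integral_rpow_gap hd, hval, mul_comm] at hbd
  refine hbd.trans ?_
  have htd := Real.rpow_nonneg ht.1.le d
  have : 0 ≤ r⁻¹ := by positivity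
  rw [mul_one_div, div_eq_mul_inv β]
  gcongr
  linarith

end IsShrinkage

end

/-! ### Contraction on conical domains -/

section

/-- The union over `t ∈ (0,T)` of the discs of radius `r - Ψ(t)`. -/
def cone (T : ℝ) (Ψ : ℝ → ℝ) (r : ℝ) : Set (ℝ × ℂ) :=
  {p | p.1 ∈ Ioo 0 T ∧ ‖p.2‖ + Ψ p.1 < r}

variable {lam : ℂ} {T R ρ d η C r N : ℝ} {W Ψ : ℝ → ℝ} {F : ℝ → ℂ × ℂ × ℂ → ℂ}
  {u v : ℝ → ℂ → ℂ}

lemma cone_mono {r' : ℝ} (h : r ≤ r') : cone T Ψ r ⊆ cone T Ψ r' :=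
  fun _ hp => ⟨hp.1, hp.2.trans_le h⟩

namespace IsShrinkage

lemma isOpen_cone (hW : IsShrinkage T W Ψ) : IsOpen (cone T Ψ r) := by
  rw [isOpen_iff_mem_nhds]
  intro p hp
  have h1 : ContinuousAt (fun q : ℝ × ℂ => ‖q.2‖ + Ψ q.1) p := by
    have h2 : ContinuousAt Ψ p.1 := (hW.hasDerivAt _ hp.1).continuousAt
    exact continuousAt_snd.norm.add (h2.comp continuousAt_fst)
  have h3 : ∀ᶠ q : ℝ × ℂ in 𝓝 p, q.1 ∈ Ioo 0 T :=
    continuousAt_fst.eventually (isOpen_Ioo.mem_nhds hp.1)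
  filter_upwards [h3, h1.eventually (gt_mem_nhds hp.2)] with q hq hq' using ⟨hq, hq'⟩

lemma mem_cone_of_le (hW : IsShrinkage T W Ψ) {p : ℝ × ℂ} (hp : p ∈ cone T Ψ r) {τ : ℝ}
    (hτ : τ ∈ Ioc 0 p.1) : (τ, p.2) ∈ cone T Ψ r := by
  refine ⟨⟨hτ.1, hτ.2.trans_lt hp.1.2⟩, ?_⟩
  have := hW.le_of_le hτ.1.le hτ.2 hp.1.2
  have := hp.2
  simp only
  linarith

lemma mul_mem_cone (hW : IsShrinkage T W Ψ) : ∀ p ∈ cone T Ψ r, ∀ s ∈ Ioc (0 : ℝ) 1,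
    (p.1 * s, p.2) ∈ cone T Ψ r := fun _ hp _ hs =>
  hW.mem_cone_of_le hp ⟨mul_pos hp.1.1 hs.1, mul_le_of_le_one_right hp.1.1.le hs.2⟩

lemma exists_Ioo_subset_cone (hW : IsShrinkage T W Ψ) {p : ℝ × ℂ} (hp : p ∈ cone T Ψ r) :
    ∃ T' > p.1, ∀ τ ∈ Ioo 0 T', (τ, p.2) ∈ cone T Ψ r := by
  obtain ⟨δ, hδ, h⟩ := exists_ball_prod_subset hW.isOpen_cone hp
  refine ⟨p.1 + δ, by linarith, fun τ hτ => ?_⟩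
  rcases le_or_gt τ p.1 with h1 | h1
  · exact hW.mem_cone_of_le hp ⟨hτ.1, h1⟩
  · refine h ⟨?_, mem_ball_self hδ⟩
    rw [mem_ball, Real.dist_eq, abs_of_pos (sub_pos.2 h1)]
    linarith [hτ.2]

lemma norm_lt_of_mem_cone (hW : IsShrinkage T W Ψ) {p : ℝ × ℂ} (hp : p ∈ cone T Ψ r) :
    ‖p.2‖ < r := by
  have := hW.psi_nonneg ⟨hp.1.1.le, hp.1.2⟩
  have := hp.2
  linarith

lemma cone_bounds (hW : IsShrinkage T W Ψ) (hr : r ≤ R) :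
    ∀ p ∈ cone T Ψ r, p.1 ∈ Ioo 0 T ∧ ‖p.2‖ < R :=
  fun _ hp => ⟨hp.1, (hW.norm_lt_of_mem_cone hp).trans_le hr⟩

end IsShrinkage

lemma section_cone {t : ℝ} (ht : t ∈ Ioo 0 T) {x : ℂ} :
    (t, x) ∈ cone T Ψ r ↔ x ∈ ball (0 : ℂ) (r - Ψ t) := by
  rw [mem_ball_zero_iff, lt_sub_iff_add_lt]
  exact and_iff_right ht

/-- Nagumo's estimate: a bound by `1 / δ`, with `δ` the distance to the boundary of the disc,
gives a bound of the derivative by `4 / δ²`. -/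
lemma norm_deriv_le_of_cone (hu : HolomorphicIn (cone T Ψ r) u) {N : ℝ}
    (hN : 0 ≤ N) (h : ∀ p ∈ cone T Ψ r, ‖u p.1 p.2‖ ≤ N / (r - ‖p.2‖ - Ψ p.1) * p.1 ^ d) :
    ∀ p ∈ cone T Ψ r, ‖deriv (u p.1) p.2‖ ≤ 4 * N / (r - ‖p.2‖ - Ψ p.1) ^ 2 * p.1 ^ d := by
  intro p hp
  have hD : 0 < r - ‖p.2‖ - Ψ p.1 := by linarith [hp.2]
  set D := r - ‖p.2‖ - Ψ p.1 with hDdef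
  have htd := Real.rpow_nonneg hp.1.1.le d
  have hmem : ∀ y ∈ closedBall p.2 (D / 2), D / 2 ≤ r - ‖y‖ - Ψ p.1 ∧ (p.1, y) ∈ cone T Ψ r := by
    intro y hy
    have h1 : ‖y - p.2‖ ≤ D / 2 := by simpa [dist_eq_norm] using hy
    have h2 := norm_le_norm_add_norm_sub' y p.2
    exact ⟨by linarith, hp.1, by simp only; linarith⟩
  have := norm_deriv_le_of_closedBall (f := u p.1) (C := N / (D / 2) * p.1 ^ d) (half_pos hD)
    (fun y hy => hu.2 (p.1, y) (hmem y hy).2) fun y hy => by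
      refine (h (p.1, y) (hmem y hy).2).trans ?_
      have := (hmem y hy).1
      have : 0 < D / 2 := half_pos hD
      simp only
      gcongr
  refine this.trans (le_of_eq ?_)
  field_simp
  ring

/-- The right-hand side of `t u_t - λ u = F(t, x, u, u_x) - λ u`. -/
noncomputable def source (F : ℝ → ℂ × ℂ × ℂ → ℂ) (lam : ℂ) (u : ℝ → ℂ → ℂ) (t : ℝ) (x : ℂ) : ℂ :=
  F t (x, u t x, deriv (u t) x) - lam * u t x

/-- The map whose fixed points are the solutions of `t u_t = F(t, x, u, u_x)`
that decay fast enough at `t = 0`. -/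
noncomputable def picard (F : ℝ → ℂ × ℂ × ℂ → ℂ) (lam : ℂ) (u : ℝ → ℂ → ℂ) (t : ℝ) (x : ℂ) : ℂ :=
  eulerInt lam (fun τ => source F lam u τ x) t

/-- The conditions on `F`, near `(0,0,0,0)`, under which `picard` contracts: for arguments of size
at most `t^d`, the function `F - λ z₁` has a small Lipschitz constant in `z₁` (relative to
`d - Re λ`) and Lipschitz constant `W(t) / 64` in `z₂`. The constant `η` measures the inhomogeneous
term `F(t,x,0,0)`, and `C` bounds `W`. -/
structure IsContractive (F : ℝ → ℂ × ℂ × ℂ → ℂ) (lam : ℂ) (T R ρ d η C : ℝ) (W : ℝ → ℝ) :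
    Prop where
  lam_lt : lam.re < d
  continuousOn : ContinuousOn (fun p : ℝ × (ℂ × ℂ × ℂ) => F p.1 p.2)
    (Ioo 0 T ×ˢ (ball 0 R ×ˢ ball 0 ρ ×ˢ ball 0 ρ))
  holomorphic : ∀ t ∈ Ioo 0 T, DifferentiableOn ℂ (F t) (ball 0 R ×ˢ ball 0 ρ ×ˢ ball 0 ρ)
  rpow_lt : ∀ t ∈ Ioo 0 T, t ^ d < ρ
  norm_zero_le : ∀ t ∈ Ioo 0 T, ∀ x ∈ ball (0 : ℂ) R, ‖F t (x, 0, 0)‖ ≤ η * t ^ d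
  lipschitz : ∀ t ∈ Ioo 0 T, ∀ x ∈ ball (0 : ℂ) R, ∀ z₁ z₂ w₁ w₂ : ℂ, ‖z₁‖ ≤ t ^ d →
    ‖z₂‖ ≤ t ^ d → ‖w₁‖ ≤ t ^ d → ‖w₂‖ ≤ t ^ d →
    ‖F t (x, z₁, z₂) - F t (x, w₁, w₂) - lam * (z₁ - w₁)‖ ≤
      (d - lam.re) / 16 * ‖z₁ - w₁‖ + W t / 64 * ‖z₂ - w₂‖
  weight_nonneg : ∀ t ∈ Ioo 0 T, 0 ≤ W t
  weight_le : ∀ t ∈ Ioo 0 T, W t ≤ C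

/-- `u` is holomorphic in `x`, and `u`, `∂u/∂x` are at most `t^d`. -/
structure IsSmall (Ω : Set (ℝ × ℂ)) (d : ℝ) (u : ℝ → ℂ → ℂ) : Prop where
  holomorphicIn : HolomorphicIn Ω u
  norm_le : ∀ p ∈ Ω, ‖u p.1 p.2‖ ≤ p.1 ^ d
  norm_deriv_le : ∀ p ∈ Ω, ‖deriv (u p.1) p.2‖ ≤ p.1 ^ d

lemma IsSmall.mono {Ω Ω' : Set (ℝ × ℂ)} (hu : IsSmall Ω d u) (h : Ω' ⊆ Ω) : IsSmall Ω' d u :=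
  ⟨hu.1.mono h, fun p hp => hu.2 p (h hp), fun p hp => hu.3 p (h hp)⟩

namespace IsContractive

lemma norm_source_le (hF : IsContractive F lam T R ρ d η C W)
    {Ω : Set (ℝ × ℂ)} (hΩ : ∀ p ∈ Ω, p.1 ∈ Ioo 0 T ∧ ‖p.2‖ < R)
    (hu : IsSmall Ω d u) :
    ∀ p ∈ Ω, ‖source F lam u p.1 p.2‖ ≤ (η + (d - lam.re) / 16 + C / 64) * p.1 ^ d := by
  intro p hp
  obtain ⟨ht, hx⟩ := hΩ p hp
  have htd : 0 ≤ p.1 ^ d := Real.rpow_nonneg ht.1.le d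
  have hx : p.2 ∈ ball (0 : ℂ) R := by simpa using hx
  have h1 := hF.lipschitz _ ht _ hx _ _ 0 0 (hu.2 p hp) (hu.3 p hp) (by simpa) (by simpa)
  have h2 := hF.norm_zero_le _ ht _ hx
  have e : source F lam u p.1 p.2 = (F p.1 (p.2, u p.1 p.2, deriv (u p.1) p.2) - F p.1 (p.2, 0, 0)
      - lam * (u p.1 p.2 - 0)) + F p.1 (p.2, 0, 0) := by
    rw [source]; ring
  rw [e]
  refine (norm_add_le _ _).trans ((add_le_add h1 h2).trans ?_)
  rw [sub_zero, sub_zero]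
  have h3 := hu.2 p hp
  have h4 := hu.3 p hp
  have h5 := hF.weight_le _ ht
  have h6 := hF.weight_nonneg _ ht
  have h8 : 0 ≤ C / 64 := by linarith
  have h7 : 0 ≤ d - lam.re := by linarith [hF.lam_lt]
  calc _ ≤ (d - lam.re) / 16 * p.1 ^ d + C / 64 * p.1 ^ d + η * p.1 ^ d := by gcongr
    _ = _ := by ring

lemma source_arg_mem (hF : IsContractive F lam T R ρ d η C W)
    {Ω : Set (ℝ × ℂ)} (hΩ : ∀ p ∈ Ω, p.1 ∈ Ioo 0 T ∧ ‖p.2‖ < R)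
    (hu : IsSmall Ω d u) {p : ℝ × ℂ} (hp : p ∈ Ω) :
    (p.2, u p.1 p.2, deriv (u p.1) p.2) ∈ (ball 0 R ×ˢ ball 0 ρ ×ˢ ball 0 ρ : Set (ℂ × ℂ × ℂ)) := by
  have := hF.rpow_lt _ (hΩ p hp).1
  refine ⟨by simpa using (hΩ p hp).2, ?_, ?_⟩ <;> rw [mem_ball_zero_iff]
  · exact (hu.2 p hp).trans_lt this
  · exact (hu.3 p hp).trans_lt this

lemma holomorphicIn_source (hF : IsContractive F lam T R ρ d η C W)
    {Ω : Set (ℝ × ℂ)} (hΩo : IsOpen Ω)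
    (hΩ : ∀ p ∈ Ω, p.1 ∈ Ioo 0 T ∧ ‖p.2‖ < R) (hu : IsSmall Ω d u) :
    HolomorphicIn Ω (source F lam u) := by
  have hopen : IsOpen (ball 0 R ×ˢ ball 0 ρ ×ˢ ball 0 ρ : Set (ℂ × ℂ × ℂ)) :=
    isOpen_ball.prod (isOpen_ball.prod isOpen_ball)
  refine ⟨?_, fun p hp => ?_⟩
  · refine ContinuousOn.sub (hF.continuousOn.comp (f := fun p : ℝ × ℂ =>
      (p.1, (p.2, u p.1 p.2, deriv (u p.1) p.2))) ?_ ?_) (continuousOn_const.mul hu.1.1)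
    · exact continuousOn_fst.prodMk (continuousOn_snd.prodMk
        (hu.1.1.prodMk (hu.1.deriv hΩo).1))
    · exact fun p hp => ⟨(hΩ p hp).1, hF.source_arg_mem hΩ hu hp⟩
  · have h1 := (hF.holomorphic _ (hΩ p hp).1).differentiableAt
      (hopen.mem_nhds (hF.source_arg_mem hΩ hu hp))
    have h2 : DifferentiableAt ℂ (fun x : ℂ => (x, u p.1 x, deriv (u p.1) x)) p.2 :=
      differentiableAt_id.prodMk ((hu.1.2 p hp).prodMk ((hu.1.deriv hΩo).2 p hp))
    exact (h1.comp (f := fun x : ℂ => (x, u p.1 x, deriv (u p.1) x)) p.2 h2).sub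
      ((hu.1.2 p hp).const_mul lam)

lemma source_const_nonneg (hF : IsContractive F lam T R ρ d η C W)
    (hη : 0 ≤ η) (hT : 0 < T) : 0 ≤ η + (d - lam.re) / 16 + C / 64 := by
  have ht : T / 2 ∈ Ioo 0 T := ⟨by linarith, by linarith⟩
  have := (hF.weight_nonneg _ ht).trans (hF.weight_le _ ht)
  have := hF.lam_lt
  linarith

lemma holomorphicIn_picard (hF : IsContractive F lam T R ρ d η C W)
    (hW : IsShrinkage T W Ψ) (hη : 0 ≤ η) (hT : 0 < T) (hr : r ≤ R)
    (hu : IsSmall (cone T Ψ r) d u) : HolomorphicIn (cone T Ψ r) (picard F lam u) :=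
  HolomorphicIn.eulerInt hW.isOpen_cone (fun _ hp => hp.1.1) hW.mul_mem_cone hF.lam_lt
    (hF.source_const_nonneg hη hT)
    (hF.holomorphicIn_source hW.isOpen_cone (hW.cone_bounds hr) hu)
    (hF.norm_source_le (hW.cone_bounds hr) hu)

/-- On a segment `(0,T') × {x}` of the cone the right-hand side meets the
assumptions of the lemmas on `eulerInt`. -/
lemma source_section (hF : IsContractive F lam T R ρ d η C W)
    (hW : IsShrinkage T W Ψ) (hr : r ≤ R) (hu : IsSmall (cone T Ψ r) d u) {T' : ℝ} {x : ℂ}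
    (h : ∀ τ ∈ Ioo 0 T', (τ, x) ∈ cone T Ψ r) :
    ContinuousOn (fun τ => source F lam u τ x) (Ioo 0 T') ∧ ∀ τ ∈ Ioo 0 T',
      ‖source F lam u τ x‖ ≤ (η + (d - lam.re) / 16 + C / 64) * τ ^ d := by
  refine ⟨?_, fun τ hτ => hF.norm_source_le (hW.cone_bounds hr) hu (τ, x) (h τ hτ)⟩
  exact (hF.holomorphicIn_source hW.isOpen_cone (hW.cone_bounds hr) hu).1.comp
    (f := fun τ : ℝ => (τ, x)) (by fun_prop) h

/-- The contraction estimate, in the norm weighted by the distance to the boundary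
of the shrinking disc. -/
lemma norm_picard_sub_le (hF : IsContractive F lam T R ρ d η C W)
    (hW : IsShrinkage T W Ψ) (hr : r ≤ R) (hu : IsSmall (cone T Ψ r) d u)
    (hv : IsSmall (cone T Ψ r) d v) (hN : 0 ≤ N)
    (h : ∀ p ∈ cone T Ψ r, ‖u p.1 p.2 - v p.1 p.2‖ ≤ N / (r - ‖p.2‖ - Ψ p.1) * p.1 ^ d) :
    ∀ p ∈ cone T Ψ r, ‖picard F lam u p.1 p.2 - picard F lam v p.1 p.2‖ ≤
      N / 8 / (r - ‖p.2‖ - Ψ p.1) * p.1 ^ d := by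
  intro p hp
  obtain ⟨T', hT', hsec⟩ := hW.exists_Ioo_subset_cone hp
  have hu' := hF.source_section hW hr hu hsec
  have hv' := hF.source_section hW hr hv hsec
  have hpT : p.1 ∈ Ioo 0 T' := ⟨hp.1.1, hT'⟩
  rw [picard, picard, ← eulerInt_sub hF.lam_lt hu'.1 hu'.2 hv'.1 hv'.2 hpT]
  have hderiv := norm_deriv_le_of_cone (hu.1.sub hv.1) hN h
  have hgap : 0 < d - lam.re := by linarith [hF.lam_lt]
  have hD : 0 < r - ‖p.2‖ - Ψ p.1 := by linarith [hp.2]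
  have key := hW.norm_eulerInt_le hF.lam_lt (r := r - ‖p.2‖)
    (h := fun τ => source F lam u τ p.2 - source F lam v τ p.2)
    (α := (d - lam.re) / 16 * (N / (r - ‖p.2‖ - Ψ p.1))) (β := N / 16) hp.1
    (by linarith) (by positivity) ?_
  · refine key.trans (le_of_eq ?_)
    field_simp
    ring
  · intro τ hτ
    have hq : (τ, p.2) ∈ cone T Ψ r := hW.mem_cone_of_le hp hτ
    have hx : p.2 ∈ ball (0 : ℂ) R := by
      simpa using (hW.cone_bounds hr p hp).2
    have htd : 0 ≤ τ ^ d := Real.rpow_nonneg hτ.1.le d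
    have h1 := hF.lipschitz τ hq.1 p.2 hx _ _ _ _ (hu.2 _ hq) (hu.3 _ hq) (hv.2 _ hq) (hv.3 _ hq)
    have e : source F lam u τ p.2 - source F lam v τ p.2 =
        F τ (p.2, u τ p.2, deriv (u τ) p.2) - F τ (p.2, v τ p.2, deriv (v τ) p.2)
          - lam * (u τ p.2 - v τ p.2) := by
      rw [source, source]; ring
    have h2 := h _ hq
    have h3 := hderiv _ hq
    simp only at h1 h2 h3
    rw [deriv_fun_sub (hu.1.2 _ hq) (hv.1.2 _ hq)] at h3
    have hle : Ψ τ ≤ Ψ p.1 := hW.le_of_le hτ.1.le hτ.2 hp.1.2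
    have hw := hF.weight_nonneg τ hq.1
    rw [e]
    refine h1.trans ?_
    calc _ ≤ (d - lam.re) / 16 * (N / (r - ‖p.2‖ - Ψ p.1) * τ ^ d) +
          W τ / 64 * (4 * N / (r - ‖p.2‖ - Ψ τ) ^ 2 * τ ^ d) := by
          gcongr
          exact h2.trans (by gcongr)
      _ = _ := by ring

/-- Two small solutions coincide: their difference is bounded by `N 8^{-k}`
for every `k`. -/
lemma eq_of_solutions (hF : IsContractive F lam T R ρ d η C W)
    (hW : IsShrinkage T W Ψ) (hr : r ≤ R) (hu : IsSmall (cone T Ψ r) d u)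
    (hv : IsSmall (cone T Ψ r) d v)
    (hu' : ∀ p ∈ cone T Ψ r, HasDerivAt (fun s => u s p.2)
      (F p.1 (p.2, u p.1 p.2, deriv (u p.1) p.2) / p.1) p.1)
    (hv' : ∀ p ∈ cone T Ψ r, HasDerivAt (fun s => v s p.2)
      (F p.1 (p.2, v p.1 p.2, deriv (v p.1) p.2) / p.1) p.1) :
    ∀ p ∈ cone T Ψ r, u p.1 p.2 = v p.1 p.2 := by
  have hfix : ∀ {w : ℝ → ℂ → ℂ}, IsSmall (cone T Ψ r) d w → (∀ p ∈ cone T Ψ r,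
      HasDerivAt (fun s => w s p.2) (F p.1 (p.2, w p.1 p.2, deriv (w p.1) p.2) / p.1) p.1) →
      ∀ p ∈ cone T Ψ r, w p.1 p.2 = picard F lam w p.1 p.2 := by
    intro w hw hw' p hp
    obtain ⟨T', hT', hsec⟩ := hW.exists_Ioo_subset_cone hp
    obtain ⟨h1, h2⟩ := hF.source_section hW hr hw hsec
    set K := max (η + (d - lam.re) / 16 + C / 64) 1 with hK
    refine eq_eulerInt (C := K) (T := T') (y := fun τ => w τ p.2) hF.lam_lt h1 ?_ ?_ ?_
      ⟨hp.1.1, hT'⟩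
    · intro τ hτ
      have := Real.rpow_nonneg hτ.1.le d
      exact (h2 τ hτ).trans (by gcongr; exact le_max_left _ _)
    · intro τ hτ
      refine (hw' _ (hsec τ hτ)).congr_deriv ?_
      simp [source]
    · intro τ hτ
      have := Real.rpow_nonneg hτ.1.le d
      refine (hw.2 _ (hsec τ hτ)).trans ?_
      exact le_mul_of_one_le_left this (le_max_right _ _)
  have hk : ∀ k : ℕ, ∀ p ∈ cone T Ψ r,
      ‖u p.1 p.2 - v p.1 p.2‖ ≤ (2 * R * (1 / 8) ^ k) / (r - ‖p.2‖ - Ψ p.1) * p.1 ^ d := by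
    intro k
    induction k with
    | zero =>
      intro p hp
      have hD : 0 < r - ‖p.2‖ - Ψ p.1 := by linarith [hp.2]
      have hD' : r - ‖p.2‖ - Ψ p.1 ≤ R := by
        linarith [hW.psi_nonneg ⟨hp.1.1.le, hp.1.2⟩, norm_nonneg p.2]
      have htd : 0 ≤ p.1 ^ d := Real.rpow_nonneg hp.1.1.le d
      have h1 : 2 ≤ 2 * R * (1 / 8) ^ 0 / (r - ‖p.2‖ - Ψ p.1) := by
        rw [le_div_iff₀ hD]; linarith
      calc _ ≤ ‖u p.1 p.2‖ + ‖v p.1 p.2‖ := norm_sub_le _ _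
        _ ≤ 2 * p.1 ^ d := by linarith [hu.2 p hp, hv.2 p hp]
        _ ≤ _ := by gcongr
    | succ k ih =>
      intro p hp
      rw [hfix hu hu' p hp, hfix hv hv' p hp]
      have hR : 0 ≤ R := (norm_nonneg _).trans (hW.cone_bounds hr p hp).2.le
      refine (hF.norm_picard_sub_le hW hr hu hv (by positivity) ih p hp).trans (le_of_eq ?_)
      ring
  intro p hp
  have hlim : Tendsto (fun k : ℕ => (2 * R * (1 / 8) ^ k) / (r - ‖p.2‖ - Ψ p.1) * p.1 ^ d) atTop
      (𝓝 0) := by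
    have h1 := tendsto_pow_atTop_nhds_zero_of_lt_one (r := (1 / 8 : ℝ)) (by norm_num) (by norm_num)
    have h2 := ((h1.const_mul (2 * R)).div_const (r - ‖p.2‖ - Ψ p.1)).mul_const (p.1 ^ d)
    simpa using h2
  have := ge_of_tendsto' hlim fun k => hk k p hp
  exact sub_eq_zero.1 (norm_le_zero_iff.1 this)

end IsContractive

end

/-! ### Successive approximation -/

section

variable {lam : ℂ} {T R ρ d η C r : ℝ} {W Ψ : ℝ → ℝ} {F : ℝ → ℂ × ℂ × ℂ → ℂ}

/-- The successive approximations, starting from `0`. -/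
noncomputable def iter (F : ℝ → ℂ × ℂ × ℂ → ℂ) (lam : ℂ) : ℕ → ℝ → ℂ → ℂ
  | 0 => fun _ _ => 0
  | k + 1 => picard F lam (iter F lam k)

/-- The radius of the cone on which the `k`-th approximation is controlled. -/
noncomputable def iterRadius (R : ℝ) (k : ℕ) : ℝ := R / 2 + R / 2 * (1 / 2) ^ k

lemma iterRadius_succ (R : ℝ) (k : ℕ) :
    iterRadius R (k + 1) = iterRadius R k - R / 4 * (1 / 2) ^ k := by
  rw [iterRadius, iterRadius, pow_succ]; ring

lemma iterRadius_le (hR : 0 ≤ R) (k : ℕ) : iterRadius R k ≤ R := by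
  have : (1 / 2 : ℝ) ^ k ≤ 1 := pow_le_one₀ (by norm_num) (by norm_num)
  rw [iterRadius]; nlinarith

lemma half_le_iterRadius (hR : 0 ≤ R) (k : ℕ) : R / 2 ≤ iterRadius R k := by
  have : 0 ≤ R / 2 * (1 / 2) ^ k := by positivity
  rw [iterRadius]; linarith

lemma IsSmall.zero (hT : ∀ p ∈ cone T Ψ r, 0 ≤ p.1) :
    IsSmall (cone T Ψ r) d (fun _ _ => 0) where
  holomorphicIn := ⟨continuousOn_const, fun _ _ => differentiableAt_const _⟩
  norm_le p hp := by simpa using Real.rpow_nonneg (hT p hp) d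
  norm_deriv_le p hp := by simpa using Real.rpow_nonneg (hT p hp) d

/-- Nagumo's estimate on the cone of radius `iterRadius R (k + 1)`. -/
lemma norm_increment_le {w : ℝ → ℂ → ℂ} {k : ℕ} (hR : 0 < R) (hR1 : R ≤ 1)
    (hw : HolomorphicIn (cone T Ψ (iterRadius R k)) w)
    (h : ∀ p ∈ cone T Ψ (iterRadius R k), ‖w p.1 p.2‖ ≤
      (R ^ 2 / 128 * (1 / 8) ^ k) / (iterRadius R k - ‖p.2‖ - Ψ p.1) * p.1 ^ d) :
    ∀ p ∈ cone T Ψ (iterRadius R (k + 1)), ‖w p.1 p.2‖ ≤ (1 / 2) ^ (k + 1) * p.1 ^ d ∧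
      ‖deriv (w p.1) p.2‖ ≤ (1 / 2) ^ (k + 1) * p.1 ^ d := by
  intro p hp
  have hsucc := iterRadius_succ R k
  have hpow : 0 < (1 / 2 : ℝ) ^ k := by positivity
  have hpos : 0 < R / 4 * (1 / 2) ^ k := by positivity
  have hp' : p ∈ cone T Ψ (iterRadius R k) := cone_mono (by linarith) hp
  have hD : R / 4 * (1 / 2) ^ k ≤ iterRadius R k - ‖p.2‖ - Ψ p.1 := by linarith [hp.2]
  have htd : 0 ≤ p.1 ^ d := Real.rpow_nonneg hp.1.1.le d
  have e8 : (1 / 8 : ℝ) ^ k = (1 / 2) ^ k * (1 / 2) ^ k * (1 / 2) ^ k := by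
    rw [← mul_pow, ← mul_pow]; norm_num
  constructor
  · refine (h p hp').trans ?_
    gcongr
    calc _ ≤ (R ^ 2 / 128 * (1 / 8) ^ k) / (R / 4 * (1 / 2) ^ k) := by gcongr
      _ = R / 32 * ((1 / 2) ^ k * (1 / 2) ^ k) := by rw [e8]; field_simp; norm_num
      _ ≤ 1 / 32 * (1 * (1 / 2) ^ k) := by
          gcongr
          exact pow_le_one₀ (by norm_num) (by norm_num)
      _ ≤ _ := by rw [pow_succ]; linarith
  · refine (norm_deriv_le_of_cone hw (by positivity) h p hp').trans ?_
    gcongr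
    calc _ ≤ 4 * (R ^ 2 / 128 * (1 / 8) ^ k) / (R / 4 * (1 / 2) ^ k) ^ 2 := by gcongr
      _ = _ := by rw [e8, pow_succ (1 / 2 : ℝ) k]; field_simp; norm_num

namespace IsContractive

/-- Consecutive approximations differ by `O(8^{-k} / δ)`. Passing to the next cone costs a factor
`4^k` in the derivative, so that the increments remain summable and the approximations
small. -/
lemma iter_bounds (hF : IsContractive F lam T R ρ d η C W) (hW : IsShrinkage T W Ψ) (hT : 0 < T)
    (hR : 0 < R) (hR1 : R ≤ 1) (hη : 0 ≤ η) (hηR : η ≤ (d - lam.re) * (R / 128)) (k : ℕ) :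
    (HolomorphicIn (cone T Ψ (iterRadius R k)) (iter F lam k) ∧
      (∀ p ∈ cone T Ψ (iterRadius R k), ‖iter F lam k p.1 p.2‖ ≤ (1 - (1 / 2) ^ k) * p.1 ^ d) ∧
      (∀ p ∈ cone T Ψ (iterRadius R k),
        ‖deriv (iter F lam k p.1) p.2‖ ≤ (1 - (1 / 2) ^ k) * p.1 ^ d)) ∧
    ∀ p ∈ cone T Ψ (iterRadius R k), ‖iter F lam (k + 1) p.1 p.2 - iter F lam k p.1 p.2‖ ≤
      (R ^ 2 / 128 * (1 / 8) ^ k) / (iterRadius R k - ‖p.2‖ - Ψ p.1) * p.1 ^ d := by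
  induction k with
  | zero =>
    have h0 : IsSmall (cone T Ψ (iterRadius R 0)) d (fun _ _ => 0) :=
      IsSmall.zero fun p hp => hp.1.1.le
    refine ⟨⟨h0.1, fun p hp => by simp [iter], fun p hp => by simp [iter]⟩, fun p hp => ?_⟩
    have hrad := iterRadius_le hR.le 0
    have hgap : 0 < d - lam.re := by linarith [hF.lam_lt]
    have hD : 0 < iterRadius R 0 - ‖p.2‖ - Ψ p.1 := by linarith [hp.2]
    have hD' : iterRadius R 0 - ‖p.2‖ - Ψ p.1 ≤ R := by
      linarith [hW.psi_nonneg ⟨hp.1.1.le, hp.1.2⟩, norm_nonneg p.2]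
    have htd : 0 ≤ p.1 ^ d := Real.rpow_nonneg hp.1.1.le d
    have key := hW.norm_eulerInt_le hF.lam_lt (h := fun τ => source F lam (fun _ _ => 0) τ p.2)
      (r := iterRadius R 0 - ‖p.2‖) (α := η) (β := 0) hp.1 (by linarith) le_rfl (by
        intro τ hτ
        have hx : p.2 ∈ ball (0 : ℂ) R := by
          simpa using (hW.cone_bounds hrad p hp).2
        simpa [source] using hF.norm_zero_le τ ⟨hτ.1, hτ.2.trans_lt hp.1.2⟩ p.2 hx)
    simp only [iter, sub_zero, picard]
    refine key.trans ?_
    gcongr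
    have h1 : η / (d - lam.re) ≤ R / 128 := by rw [div_le_iff₀ hgap]; linarith
    have h2 : R / 128 ≤ R ^ 2 / 128 * (1 / 8) ^ 0 / (iterRadius R 0 - ‖p.2‖ - Ψ p.1) := by
      rw [le_div_iff₀ hD, pow_zero]
      calc R / 128 * (iterRadius R 0 - ‖p.2‖ - Ψ p.1) ≤ R / 128 * R := by gcongr
        _ = _ := by ring
    rw [zero_div, add_zero]
    exact h1.trans h2
  | succ k ih =>
    obtain ⟨⟨h1, h2, h3⟩, h4⟩ := ih
    have hrad := iterRadius_le hR.le k
    have hrad' := iterRadius_le hR.le (k + 1)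
    have hle : iterRadius R (k + 1) ≤ iterRadius R k := by
      have : 0 ≤ R / 4 * (1 / 2) ^ k := by positivity
      linarith [iterRadius_succ R k]
    have hsub : cone T Ψ (iterRadius R (k + 1)) ⊆ cone T Ψ (iterRadius R k) := cone_mono hle
    have hsmall : ∀ {Ω : Set (ℝ × ℂ)} {w : ℝ → ℂ → ℂ} (n : ℕ), (∀ p ∈ Ω, 0 < p.1) →
        HolomorphicIn Ω w → (∀ p ∈ Ω, ‖w p.1 p.2‖ ≤ (1 - (1 / 2) ^ n) * p.1 ^ d) →
        (∀ p ∈ Ω, ‖deriv (w p.1) p.2‖ ≤ (1 - (1 / 2) ^ n) * p.1 ^ d) → IsSmall Ω d w := by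
      intro Ω w n hpos a b c
      have hn : (1 - (1 / 2) ^ n : ℝ) ≤ 1 := by
        have : (0 : ℝ) ≤ (1 / 2) ^ n := by positivity
        linarith
      refine ⟨a, fun p hp => (b p hp).trans ?_, fun p hp => (c p hp).trans ?_⟩ <;>
        exact mul_le_of_le_one_left (Real.rpow_nonneg (hpos p hp).le d) hn
    have hs := hsmall k (fun p hp => hp.1.1) h1 h2 h3
    have hhol : HolomorphicIn (cone T Ψ (iterRadius R k)) (iter F lam (k + 1)) :=
      hF.holomorphicIn_picard hW hη hT hrad hs
    have hinc := norm_increment_le hR hR1 (hhol.sub h1) h4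
    have epow : (1 / 2 : ℝ) ^ (k + 1) = (1 / 2) ^ k / 2 := by rw [pow_succ]; ring
    have hb : ∀ p ∈ cone T Ψ (iterRadius R (k + 1)),
        ‖iter F lam (k + 1) p.1 p.2‖ ≤ (1 - (1 / 2) ^ (k + 1)) * p.1 ^ d := by
      intro p hp
      have a := norm_le_norm_add_norm_sub' (iter F lam (k + 1) p.1 p.2) (iter F lam k p.1 p.2)
      have b := (hinc p hp).1
      have c := h2 p (hsub hp)
      rw [epow] at b ⊢
      linarith
    have hb' : ∀ p ∈ cone T Ψ (iterRadius R (k + 1)),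
        ‖deriv (iter F lam (k + 1) p.1) p.2‖ ≤ (1 - (1 / 2) ^ (k + 1)) * p.1 ^ d := by
      intro p hp
      have a := norm_le_norm_add_norm_sub' (deriv (iter F lam (k + 1) p.1) p.2)
        (deriv (iter F lam k p.1) p.2)
      have b := (hinc p hp).2
      rw [deriv_fun_sub (hhol.2 p (hsub hp)) (h1.2 p (hsub hp))] at b
      have c := h3 p (hsub hp)
      rw [epow] at b ⊢
      linarith
    refine ⟨⟨hhol.mono hsub, hb, hb'⟩, fun p hp => ?_⟩
    have := hF.norm_picard_sub_le hW hrad' (hsmall (k + 1) (fun p hp => hp.1.1) (hhol.mono hsub)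
      hb hb') (hs.mono hsub) (N := R ^ 2 / 128 * (1 / 8) ^ k) (by positivity) (by
        intro q hq
        refine (h4 q (hsub hq)).trans ?_
        have : 0 < iterRadius R (k + 1) - ‖q.2‖ - Ψ q.1 := by linarith [hq.2]
        have htd : 0 ≤ q.1 ^ d := Real.rpow_nonneg hq.1.1.le d
        gcongr) p hp
    refine this.trans (le_of_eq ?_)
    rw [pow_succ]
    ring

/-- The successive approximations converge to a small fixed point on the cone of half radius. -/
lemma exists_fixedPoint (hF : IsContractive F lam T R ρ d η C W) (hW : IsShrinkage T W Ψ)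
    (hT : 0 < T) (hR : 0 < R) (hR1 : R ≤ 1) (hη : 0 ≤ η) (hηR : η ≤ (d - lam.re) * (R / 128)) :
    ∃ u, IsSmall (cone T Ψ (R / 2)) d u ∧
      ∀ p ∈ cone T Ψ (R / 2), u p.1 p.2 = picard F lam u p.1 p.2 := by
  have hB := hF.iter_bounds hW hT hR hR1 hη hηR
  set A : Set (ℝ × ℂ) := cone T Ψ (R / 2) with hA
  have hAo : IsOpen A := hW.isOpen_cone
  have hsub : ∀ k, A ⊆ cone T Ψ (iterRadius R k) := fun k =>
    cone_mono (half_le_iterRadius hR.le k)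
  have hhol : ∀ k, HolomorphicIn A (iter F lam k) := fun k => (hB k).1.1.mono (hsub k)
  have hone : ∀ k : ℕ, (1 - (1 / 2) ^ k : ℝ) ≤ 1 := fun k => by
    have : (0 : ℝ) ≤ (1 / 2) ^ k := by positivity
    linarith
  have hsmall : ∀ k, IsSmall A d (iter F lam k) := fun k =>
    ⟨hhol k, fun p hp => ((hB k).1.2.1 p (hsub k hp)).trans
      (mul_le_of_le_one_left (Real.rpow_nonneg hp.1.1.le d) (hone k)),
      fun p hp => ((hB k).1.2.2 p (hsub k hp)).trans
      (mul_le_of_le_one_left (Real.rpow_nonneg hp.1.1.le d) (hone k))⟩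
  have hinc : ∀ k, ∀ p ∈ A, ‖iter F lam (k + 1) p.1 p.2 - iter F lam k p.1 p.2‖ ≤
      ρ * (1 / 2) ^ (k + 1) := by
    intro k p hp
    have h1 : HolomorphicIn (cone T Ψ (iterRadius R (k + 1))) (iter F lam k) :=
      (hB k).1.1.mono (cone_mono (by
        have : 0 ≤ R / 4 * (1 / 2) ^ k := by positivity
        linarith [iterRadius_succ R k]))
    have hs : IsSmall (cone T Ψ (iterRadius R k)) d (iter F lam k) :=
      ⟨(hB k).1.1, fun p hp => ((hB k).1.2.1 p hp).trans
        (mul_le_of_le_one_left (Real.rpow_nonneg hp.1.1.le d) (hone k)),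
        fun p hp => ((hB k).1.2.2 p hp).trans
        (mul_le_of_le_one_left (Real.rpow_nonneg hp.1.1.le d) (hone k))⟩
    have h2 : HolomorphicIn (cone T Ψ (iterRadius R k)) (iter F lam (k + 1)) :=
      hF.holomorphicIn_picard hW hη hT (iterRadius_le hR.le k) hs
    have := (norm_increment_le hR hR1 (h2.sub (hB k).1.1) (hB k).2 p (hsub (k + 1) hp)).1
    refine this.trans ?_
    rw [mul_comm]
    have := (hF.rpow_lt _ hp.1).le
    gcongr
  let u : ℝ → ℂ → ℂ := fun t x => ∑' k, (iter F lam (k + 1) t x - iter F lam k t x)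
  have hsum : Summable fun k : ℕ => ρ * (1 / 2 : ℝ) ^ (k + 1) :=
    ((summable_geometric_of_lt_one (by norm_num) (by norm_num)).comp_injective
      (add_left_injective 1)).mul_left ρ
  have hunif : TendstoUniformlyOn (fun n (p : ℝ × ℂ) => iter F lam n p.1 p.2)
      (fun p => u p.1 p.2) atTop A := by
    have := tendstoUniformlyOn_tsum_nat (f := fun k (p : ℝ × ℂ) =>
      iter F lam (k + 1) p.1 p.2 - iter F lam k p.1 p.2) hsum hinc
    refine this.congr (Eventually.of_forall fun n p _ => ?_)
    simp only
    rw [Finset.sum_range_sub (fun k => iter F lam k p.1 p.2)]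
    simp [iter]
  have hsec : ∀ t ∈ Ioo 0 T, TendstoLocallyUniformlyOn (fun n x => iter F lam n t x) (u t) atTop
      (ball 0 (R / 2 - Ψ t)) := by
    intro t ht
    refine TendstoUniformlyOn.tendstoLocallyUniformlyOn ?_
    exact (hunif.comp (fun x : ℂ => (t, x))).mono fun x hx => (section_cone ht).2 hx
  have hsecd : ∀ t ∈ Ioo 0 T, ∀ᶠ n : ℕ in atTop,
      DifferentiableOn ℂ (fun x => iter F lam n t x) (ball 0 (R / 2 - Ψ t)) := fun t ht =>
    Eventually.of_forall fun n x hx =>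
      ((hhol n).2 (t, x) ((section_cone ht).2 hx)).differentiableWithinAt
  have hlim : ∀ p ∈ A, Tendsto (fun n => iter F lam n p.1 p.2) atTop (𝓝 (u p.1 p.2)) :=
    fun p hp => hunif.tendsto_at hp
  have hlim' : ∀ p ∈ A, Tendsto (fun n => deriv (iter F lam n p.1) p.2) atTop
      (𝓝 (deriv (u p.1) p.2)) := fun p hp =>
    ((hsec p.1 hp.1).deriv (hsecd p.1 hp.1) isOpen_ball).tendsto_at ((section_cone hp.1).1 hp)
  have hu : IsSmall A d u := by
    refine ⟨⟨hunif.continuousOn (Frequently.of_forall fun n => (hhol n).1), fun p hp => ?_⟩,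
      fun p hp => ?_, fun p hp => ?_⟩
    · exact ((hsec p.1 hp.1).differentiableOn (hsecd p.1 hp.1) isOpen_ball).differentiableAt
        (isOpen_ball.mem_nhds ((section_cone hp.1).1 hp))
    · exact le_of_tendsto' (hlim p hp).norm fun n => (hsmall n).2 p hp
    · exact le_of_tendsto' (hlim' p hp).norm fun n => (hsmall n).3 p hp
  refine ⟨u, hu, fun p hp => ?_⟩
  have hRR : R / 2 ≤ R := by linarith
  have h1 : Tendsto (fun n => iter F lam (n + 1) p.1 p.2) atTop (𝓝 (u p.1 p.2)) :=
    (hlim p hp).comp (tendsto_add_atTop_nat 1)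
  refine tendsto_nhds_unique h1 ?_
  obtain ⟨T', hT', hT'sec⟩ := hW.exists_Ioo_subset_cone hp
  have hpT : p.1 ∈ Ioo 0 T' := ⟨hp.1.1, hT'⟩
  simp only [iter, picard, eulerInt]
  refine intervalIntegral.tendsto_integral_filter_of_dominated_convergence
    (fun s => ((η + (d - lam.re) / 16 + C / 64) * p.1 ^ d) * s ^ (d - lam.re - 1)) ?_ ?_ ?_ ?_
  · refine Eventually.of_forall fun n => ?_
    rw [uIoc_of_le zero_le_one]
    exact aestronglyMeasurable_eulerInt
      (continuousAt_mul_of_mem (hF.source_section hW hRR (hsmall n) hT'sec).1 hpT)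
  · refine Eventually.of_forall fun n => Eventually.of_forall fun s hs => ?_
    rw [uIoc_of_le zero_le_one] at hs
    exact norm_cpow_mul_le hs.1 hp.1.1.le rfl
      ((hF.source_section hW hRR (hsmall n) hT'sec).2 _ (mul_mem_Ioo hpT hs))
  · exact (intervalIntegrable_rpow_gap hF.lam_lt 0 1).const_mul _
  · refine Eventually.of_forall fun s hs => ?_
    rw [uIoc_of_le zero_le_one] at hs
    have hq : (p.1 * s, p.2) ∈ A := hW.mul_mem_cone p hp s hs
    refine Tendsto.const_mul _ ?_
    have hopen : IsOpen (ball 0 R ×ˢ ball 0 ρ ×ˢ ball 0 ρ : Set (ℂ × ℂ × ℂ)) :=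
      isOpen_ball.prod (isOpen_ball.prod isOpen_ball)
    have hc := ((hF.holomorphic _ hq.1).differentiableAt
      (hopen.mem_nhds (hF.source_arg_mem (hW.cone_bounds hRR) hu hq))).continuousAt
    exact (hc.tendsto.comp (tendsto_const_nhds.prodMk_nhds
      ((hlim _ hq).prodMk_nhds (hlim' _ hq)))).sub ((hlim _ hq).const_mul lam)

/-- There is a small solution on the cone of half radius. -/
lemma exists_solution (hF : IsContractive F lam T R ρ d η C W) (hW : IsShrinkage T W Ψ)
    (hT : 0 < T) (hR : 0 < R) (hR1 : R ≤ 1) (hη : 0 ≤ η) (hηR : η ≤ (d - lam.re) * (R / 128)) :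
    ∃ u, IsSmall (cone T Ψ (R / 2)) d u ∧ ∀ p ∈ cone T Ψ (R / 2), HasDerivAt (fun s => u s p.2)
      (F p.1 (p.2, u p.1 p.2, deriv (u p.1) p.2) / p.1) p.1 := by
  obtain ⟨u, hu, hfix⟩ := hF.exists_fixedPoint hW hT hR hR1 hη hηR
  refine ⟨u, hu, fun p hp => ?_⟩
  obtain ⟨T', hT', hsec⟩ := hW.exists_Ioo_subset_cone hp
  have hpT : p.1 ∈ Ioo 0 T' := ⟨hp.1.1, hT'⟩
  obtain ⟨h1, h2⟩ := hF.source_section hW (by linarith) hu hsec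
  have h3 := hasDerivAt_eulerInt hF.lam_lt h1 h2 hpT
  have h4 : (fun s => u s p.2) =ᶠ[𝓝 p.1] eulerInt lam fun τ => source F lam u τ p.2 := by
    filter_upwards [isOpen_Ioo.mem_nhds hpT] with s hs using hfix (s, p.2) (hsec s hs)
  refine (h3.congr_of_eventuallyEq h4).congr_deriv ?_
  have h5 : eulerInt lam (fun τ => source F lam u τ p.2) p.1 = u p.1 p.2 := (hfix p hp).symm
  rw [h5, source]
  ring

end IsContractive

end

/-! ### The nonlinearity near the origin -/

section

/-- The `z₂`-derivative of a bounded holomorphic function is Lipschitz at the origin. Only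
holomorphy in each variable separately is used. -/
lemma norm_deriv_snd_le {f : ℂ → ℂ → ℂ} {s L : ℝ} (hs : 0 < s)
    (h₁ : ∀ z ∈ closedBall (0 : ℂ) (3 * s), ∀ w ∈ closedBall (0 : ℂ) (3 * s),
      DifferentiableAt ℂ (fun z => f z w) z)
    (h₂ : ∀ z ∈ closedBall (0 : ℂ) (3 * s), ∀ w ∈ closedBall (0 : ℂ) (3 * s),
      DifferentiableAt ℂ (f z) w)
    (hL : ∀ z ∈ closedBall (0 : ℂ) (3 * s), ∀ w ∈ closedBall (0 : ℂ) (3 * s), ‖f z w‖ ≤ L)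
    {z w : ℂ} (hz : ‖z‖ ≤ s) (hw : ‖w‖ ≤ s) :
    ‖deriv (f z) w‖ ≤ ‖deriv (f 0) 0‖ + L / s ^ 2 * (‖z‖ + ‖w‖) := by
  have hsub : ∀ {a : ℂ} {r : ℝ}, ‖a‖ ≤ r → closedBall a s ⊆ closedBall (0 : ℂ) (r + s) := by
    intro a r ha y hy
    have h1 : ‖y - a‖ ≤ s := by simpa [dist_eq_norm] using hy
    have h2 := norm_le_norm_add_norm_sub' y a
    simp only [mem_closedBall, dist_zero_right]
    linarith
  have h3 : ∀ {r : ℝ}, r ≤ 3 * s → closedBall (0 : ℂ) r ⊆ closedBall (0 : ℂ) (3 * s) :=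
    fun h => closedBall_subset_closedBall h
  have h0 : (0 : ℂ) ∈ closedBall (0 : ℂ) (3 * s) := mem_closedBall_self (by positivity)
  have hz3 : z ∈ closedBall (0 : ℂ) (3 * s) := h3 (r := s) (by linarith) (by simpa)
  have hs' : closedBall (0 : ℂ) s ⊆ closedBall (0 : ℂ) (3 * s) := h3 (by linarith)
  have hw3 : w ∈ closedBall (0 : ℂ) (3 * s) := hs' (by simpa)
  -- the Cauchy estimate in `w` for `f z - f 0`, which is at most `L / s * ‖z‖`
  have step1 : ‖deriv (f z) w - deriv (f 0) w‖ ≤ L / s * ‖z‖ / s := by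
    rw [← deriv_fun_sub (h₂ z hz3 w hw3) (h₂ 0 h0 w hw3)]
    have hws : closedBall w s ⊆ closedBall (0 : ℂ) (3 * s) := (hsub hw).trans (h3 (by linarith))
    refine norm_deriv_le_of_closedBall hs
      (fun y hy => (h₂ z hz3 y (hws hy)).sub (h₂ 0 h0 y (hws hy))) fun y hy => ?_
    have := (convex_closedBall (0 : ℂ) s).norm_image_sub_le_of_norm_deriv_le
      (f := fun a => f a y) (C := L / s) (fun a ha => h₁ a (hs' ha) y (hws hy))
      (fun a ha => by
        have has : closedBall a s ⊆ closedBall (0 : ℂ) (3 * s) :=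
          (hsub (r := s) (by simpa using ha)).trans (h3 (by linarith))
        exact norm_deriv_le_of_closedBall hs (fun c hc => h₁ c (has hc) y (hws hy))
          fun c hc => hL c (has hc) y (hws hy))
      (mem_closedBall_self hs.le) (show z ∈ closedBall (0 : ℂ) s by simpa)
    simpa using this
  have hder : ∀ a ∈ closedBall (0 : ℂ) (2 * s), DifferentiableAt ℂ (deriv (f 0)) a ∧
      ‖deriv (f 0) a‖ ≤ L / s := by
    intro a ha
    have has : closedBall a s ⊆ closedBall (0 : ℂ) (3 * s) :=
      (hsub (r := 2 * s) (by simpa using ha)).trans (h3 (by linarith))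
    refine ⟨?_, norm_deriv_le_of_closedBall hs (fun c hc => h₂ 0 h0 c (has hc))
      fun c hc => hL 0 h0 c (has hc)⟩
    have : DifferentiableOn ℂ (f 0) (ball a s) := fun c hc =>
      (h₂ 0 h0 c (has (ball_subset_closedBall hc))).differentiableWithinAt
    exact (this.deriv isOpen_ball).differentiableAt (ball_mem_nhds _ hs)
  have step2 : ‖deriv (f 0) w - deriv (f 0) 0‖ ≤ L / s / s * ‖w‖ := by
    have := (convex_closedBall (0 : ℂ) s).norm_image_sub_le_of_norm_deriv_le
      (f := deriv (f 0)) (C := L / s / s)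
      (fun a ha => (hder a (closedBall_subset_closedBall (by linarith) ha)).1)
      (fun a ha => by
        have has : closedBall a s ⊆ closedBall (0 : ℂ) (2 * s) :=
          (hsub (r := s) (by simpa using ha)).trans (closedBall_subset_closedBall (by linarith))
        exact norm_deriv_le_of_closedBall hs (fun c hc => (hder c (has hc)).1)
          fun c hc => (hder c (has hc)).2)
      (mem_closedBall_self hs.le) (show w ∈ closedBall (0 : ℂ) s by simpa)
    simpa using this
  have e : deriv (f z) w = deriv (f 0) 0 + (deriv (f 0) w - deriv (f 0) 0) +
      (deriv (f z) w - deriv (f 0) w) := by ring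
  rw [e]
  refine (norm_add₃_le).trans ?_
  have e2 : L / s ^ 2 * (‖z‖ + ‖w‖) = L / s / s * ‖w‖ + L / s * ‖z‖ / s := by
    field_simp
    ring
  rw [e2]
  linarith

variable {T₀ R₀ ρ₀ : ℝ} {F : ℝ → ℂ × ℂ × ℂ → ℂ}

namespace IsAdmissible

lemma differentiableAt (hF : IsAdmissible T₀ R₀ ρ₀ F) {t : ℝ} (ht : t ∈ Icc 0 T₀) {x z₁ z₂ : ℂ}
    (hx : ‖x‖ < R₀) (h₁ : ‖z₁‖ < ρ₀) (h₂ : ‖z₂‖ < ρ₀) : DifferentiableAt ℂ (F t) (x, z₁, z₂) := by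
  have hopen : IsOpen (ball 0 R₀ ×ˢ ball 0 ρ₀ ×ˢ ball 0 ρ₀ : Set (ℂ × ℂ × ℂ)) :=
    isOpen_ball.prod (isOpen_ball.prod isOpen_ball)
  exact (hF.holomorphic t ht).differentiableAt
    (hopen.mem_nhds ⟨by simpa using hx, by simpa using h₁, by simpa using h₂⟩)

lemma differentiableAt_fst (hF : IsAdmissible T₀ R₀ ρ₀ F) {t : ℝ} (ht : t ∈ Icc 0 T₀)
    {x z₁ z₂ : ℂ} (hx : ‖x‖ < R₀) (h₁ : ‖z₁‖ < ρ₀) (h₂ : ‖z₂‖ < ρ₀) :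
    DifferentiableAt ℂ (fun z => F t (x, z, z₂)) z₁ :=
  (hF.differentiableAt ht hx h₁ h₂).comp (f := fun z : ℂ => (x, z, z₂)) z₁ (by fun_prop)

lemma differentiableAt_snd (hF : IsAdmissible T₀ R₀ ρ₀ F) {t : ℝ} (ht : t ∈ Icc 0 T₀)
    {x z₁ z₂ : ℂ} (hx : ‖x‖ < R₀) (h₁ : ‖z₁‖ < ρ₀) (h₂ : ‖z₂‖ < ρ₀) :
    DifferentiableAt ℂ (fun z => F t (x, z₁, z)) z₂ :=
  (hF.differentiableAt ht hx h₁ h₂).comp (f := fun z : ℂ => (x, z₁, z)) z₂ (by fun_prop)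

/-- `∂F/∂z₂` is at most `|b| + K (|z₁| + |z₂|)` near the origin. -/
lemma exists_norm_deriv_snd_le (hF : IsAdmissible T₀ R₀ ρ₀ F) (hR₀ : 0 < R₀) (hρ₀ : 0 < ρ₀) :
    ∃ K ≥ 0, ∀ t ∈ Icc 0 T₀, ∀ x z₁ z₂ : ℂ, ‖x‖ ≤ R₀ / 2 → ‖z₁‖ ≤ ρ₀ / 4 → ‖z₂‖ ≤ ρ₀ / 4 →
      ‖deriv (fun z => F t (x, z₁, z)) z₂‖ ≤ ‖coeffB F t x‖ + K * (‖z₁‖ + ‖z₂‖) := by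
  have hK : IsCompact (Icc 0 T₀ ×ˢ (closedBall 0 (R₀ / 2) ×ˢ closedBall 0 (3 * (ρ₀ / 4)) ×ˢ
      closedBall 0 (3 * (ρ₀ / 4))) : Set (ℝ × (ℂ × ℂ × ℂ))) :=
    isCompact_Icc.prod ((isCompact_closedBall _ _).prod
      ((isCompact_closedBall _ _).prod (isCompact_closedBall _ _)))
  have hρ : closedBall (0 : ℂ) (3 * (ρ₀ / 4)) ⊆ ball 0 ρ₀ :=
    closedBall_subset_ball (by linarith)
  have hR : closedBall (0 : ℂ) (R₀ / 2) ⊆ ball 0 R₀ := closedBall_subset_ball (by linarith)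
  obtain ⟨L, hL⟩ := hK.exists_bound_of_continuousOn
    (hF.continuousOn.mono (prod_mono_right (prod_mono hR (prod_mono hρ hρ))))
  refine ⟨max L 0 / (ρ₀ / 4) ^ 2, by positivity, fun t ht x z₁ z₂ hx h₁ h₂ => ?_⟩
  have hxR : ‖x‖ < R₀ := by linarith
  have hn : ∀ z ∈ closedBall (0 : ℂ) (3 * (ρ₀ / 4)), ‖z‖ < ρ₀ := fun z hz => by
    simpa using hρ hz
  exact norm_deriv_snd_le (f := fun z w => F t (x, z, w)) (by positivity)
    (fun z hz w hw => hF.differentiableAt_fst ht hxR (hn z hz) (hn w hw))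
    (fun z hz w hw => hF.differentiableAt_snd ht hxR (hn z hz) (hn w hw))
    (fun z hz w hw => (hL (t, x, z, w) ⟨ht, by simpa using hx, hz, hw⟩).trans (le_max_left _ _))
    h₁ h₂

/-- `∂F/∂z₁` is close to `λ(0,0)` near the origin. -/
lemma exists_norm_deriv_fst_sub_le (hF : IsAdmissible T₀ R₀ ρ₀ F) (hT₀ : 0 < T₀) (hR₀ : 0 < R₀)
    (hρ₀ : 0 < ρ₀) {ε : ℝ} (hε : 0 < ε) :
    ∃ δ > 0, ∀ t ∈ Icc 0 T₀, ∀ x z₁ z₂ : ℂ, ‖x‖ < R₀ → ‖z₁‖ < ρ₀ → ‖z₂‖ < ρ₀ →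
      t < δ → ‖x‖ < δ → ‖z₁‖ < δ → ‖z₂‖ < δ →
      ‖deriv (fun z => F t (x, z, z₂)) z₁ - coeffLambda F 0 0‖ ≤ ε := by
  have hc := continuousOn_deriv_of_parameter (X := ℝ × ℂ × ℂ)
    (S := Icc 0 T₀ ×ˢ (ball 0 R₀ ×ˢ ball 0 ρ₀)) (c := 0) (r := ρ₀)
    (f := fun a z => F a.1 (a.2.1, z, a.2.2))
    (hF.continuousOn.comp (f := fun p : (ℝ × ℂ × ℂ) × ℂ => (p.1.1, (p.1.2.1, p.2, p.1.2.2)))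
      (by fun_prop) fun p hp => ⟨hp.1.1, hp.1.2.1, hp.2, hp.1.2.2⟩)
    (fun a ha z hz => (hF.differentiableAt_fst ha.1 (by simpa using ha.2.1) (by simpa using hz)
      (by simpa using ha.2.2)).differentiableWithinAt)
  have hc0 := hc ((0, 0, 0), 0) ⟨⟨⟨le_rfl, hT₀.le⟩, mem_ball_self hR₀, mem_ball_self hρ₀⟩,
    mem_ball_self hρ₀⟩
  obtain ⟨δ, hδ, h⟩ := Metric.continuousWithinAt_iff.1 hc0 ε hε
  refine ⟨δ, hδ, fun t ht x z₁ z₂ hx h₁ h₂ htδ hxδ h₁δ h₂δ => ?_⟩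
  have := h (x := ((t, x, z₂), z₁)) ⟨⟨ht, by simpa using hx, by simpa using h₂⟩, by simpa using h₁⟩
    (by
      simp only [Prod.dist_eq, dist_zero_right, Real.norm_eq_abs, abs_of_nonneg ht.1, max_lt_iff]
      exact ⟨⟨htδ, hxδ, h₂δ⟩, h₁δ⟩)
  rw [dist_eq_norm] at this
  exact this.le

/-- Combination of the two derivative estimates by the mean value inequality. -/
lemma norm_sub_sub_le (hF : IsAdmissible T₀ R₀ ρ₀ F) {t e c₁ c₂ : ℝ} {x lam : ℂ}
    (ht : t ∈ Icc 0 T₀) (hx : ‖x‖ < R₀) (he : e < ρ₀)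
    (h₁ : ∀ z w : ℂ, ‖z‖ ≤ e → ‖w‖ ≤ e → ‖deriv (fun y => F t (x, y, w)) z - lam‖ ≤ c₁)
    (h₂ : ∀ z w : ℂ, ‖z‖ ≤ e → ‖w‖ ≤ e → ‖deriv (fun y => F t (x, z, y)) w‖ ≤ c₂)
    {z₁ z₂ w₁ w₂ : ℂ} (hz₁ : ‖z₁‖ ≤ e) (hz₂ : ‖z₂‖ ≤ e) (hw₁ : ‖w₁‖ ≤ e) (hw₂ : ‖w₂‖ ≤ e) :
    ‖F t (x, z₁, z₂) - F t (x, w₁, w₂) - lam * (z₁ - w₁)‖ ≤ c₁ * ‖z₁ - w₁‖ + c₂ * ‖z₂ - w₂‖ := by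
  have hd1 : ∀ a ∈ closedBall (0 : ℂ) e, DifferentiableAt ℂ (fun y => F t (x, y, z₂)) a :=
    fun a ha => hF.differentiableAt_fst ht hx
      ((mem_closedBall_zero_iff.1 ha).trans_lt he) (hz₂.trans_lt he)
  have hl : ∀ a : ℂ, HasDerivAt (fun y : ℂ => lam * y) lam a := fun a => by
    simpa using (hasDerivAt_id a).const_mul lam
  have s1 := (convex_closedBall (0 : ℂ) e).norm_image_sub_le_of_norm_deriv_le
    (f := fun y => F t (x, y, z₂) - lam * y) (C := c₁)
    (fun a ha => (hd1 a ha).sub (hl a).differentiableAt)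
    (fun a ha => by
      rw [deriv_fun_sub (hd1 a ha) (hl a).differentiableAt, (hl a).deriv]
      exact h₁ a z₂ (by simpa using ha) hz₂)
    (show w₁ ∈ closedBall (0 : ℂ) e by simpa) (show z₁ ∈ closedBall (0 : ℂ) e by simpa)
  have s2 := (convex_closedBall (0 : ℂ) e).norm_image_sub_le_of_norm_deriv_le
    (f := fun y => F t (x, w₁, y)) (C := c₂)
    (fun a ha => hF.differentiableAt_snd ht hx (hw₁.trans_lt he)
      ((mem_closedBall_zero_iff.1 ha).trans_lt he))
    (fun a ha => h₂ w₁ a hw₁ (by simpa using ha))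
    (show w₂ ∈ closedBall (0 : ℂ) e by simpa) (show z₂ ∈ closedBall (0 : ℂ) e by simpa)
  have e : F t (x, z₁, z₂) - F t (x, w₁, w₂) - lam * (z₁ - w₁) =
      (F t (x, z₁, z₂) - lam * z₁ - (F t (x, w₁, z₂) - lam * w₁)) +
        (F t (x, w₁, z₂) - F t (x, w₁, w₂)) := by ring
  rw [e]
  exact (norm_add_le _ _).trans (add_le_add s1 s2)

end IsAdmissible

/-- The shrinkage attached to `c₁ m(t) + c₂ t^d`. -/
lemma IsWeight.exists_shrinkage {m : ℝ → ℝ} (hm : IsWeight T₀ m) {c₁ c₂ d : ℝ} (hT₀ : 0 < T₀)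
    (h₁ : 0 ≤ c₁) (h₂ : 0 ≤ c₂) (hd : 0 < d) :
    ∃ Ψ, IsShrinkage T₀ (fun t => c₁ * m t + c₂ * t ^ d) Ψ ∧ Tendsto Ψ (𝓝[>] 0) (𝓝 0) := by
  set k : ℝ → ℝ := fun τ => (c₁ * m τ + c₂ * τ ^ d) / τ with hk
  have hint : IntegrableOn k (Ioc 0 T₀) := by
    have h3 : IntegrableOn (fun τ : ℝ => c₁ * (m τ / τ) + c₂ * τ ^ (d - 1)) (Ioc 0 T₀) := by
      refine (hm.integrableOn.const_mul c₁).add (Integrable.const_mul ?_ c₂)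
      exact (intervalIntegrable_iff_integrableOn_Ioc_of_le hT₀.le).1
        (intervalIntegral.intervalIntegrable_rpow' (by linarith))
    refine h3.congr_fun (fun τ hτ => ?_) measurableSet_Ioc
    simp only [hk]
    rw [Real.rpow_sub_one hτ.1.ne']
    ring
  have hkc : ContinuousOn k (Ioo 0 T₀) := by
    refine ContinuousOn.div ((continuousOn_const.mul (hm.continuousOn.mono Ioo_subset_Ioc_self)).add
      (continuousOn_const.mul ?_)) continuousOn_id fun t ht => ht.1.ne'
    exact fun t ht => (Real.continuousAt_rpow_const _ _ (Or.inl ht.1.ne')).continuousWithinAt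
  have hcont : ContinuousOn (fun t => ∫ τ in (0 : ℝ)..t, k τ) (Icc 0 T₀) := by
    have := intervalIntegral.continuousOn_primitive_interval (f := k) (a := 0) (b := T₀)
      (μ := volume) (by
        rw [uIcc_of_le hT₀.le]
        exact (integrableOn_Icc_iff_integrableOn_Ioc (by simp)).2 hint)
    rwa [uIcc_of_le hT₀.le] at this
  refine ⟨fun t => ∫ τ in (0 : ℝ)..t, k τ, ⟨hcont.mono Ico_subset_Icc_self, by simp, ?_, ?_⟩, ?_⟩
  · intro t ht
    have := (hm.pos t ⟨ht.1, ht.2.le⟩).le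
    have := Real.rpow_nonneg ht.1.le d
    positivity
  · intro t ht
    refine intervalIntegral.integral_hasDerivAt_right ?_
      (hkc.stronglyMeasurableAtFilter isOpen_Ioo t ht) (hkc.continuousAt (isOpen_Ioo.mem_nhds ht))
    rw [intervalIntegrable_iff_integrableOn_Ioc_of_le ht.1.le]
    exact hint.mono_set (Ioc_subset_Ioc_right ht.2.le)
  · have h0 := hcont 0 ⟨le_rfl, hT₀.le⟩
    rw [ContinuousWithinAt, intervalIntegral.integral_same] at h0
    refine h0.mono_left ?_
    rw [← nhdsWithin_Ioo_eq_nhdsGT hT₀]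
    exact nhdsWithin_mono _ Ioo_subset_Icc_self

lemma IsShrinkage.mono {T T' : ℝ} {W Ψ : ℝ → ℝ} (h : IsShrinkage T W Ψ) (hT : T' ≤ T) :
    IsShrinkage T' W Ψ :=
  ⟨h.1.mono (Ico_subset_Ico_right hT), h.2, fun t ht => h.3 t ⟨ht.1, ht.2.trans_le hT⟩,
    fun t ht => h.4 t ⟨ht.1, ht.2.trans_le hT⟩⟩

/-- On all small enough domains the equation meets the requirements of the contraction argument. -/
lemma IsAdmissible.exists_isContractive (hF : IsAdmissible T₀ R₀ ρ₀ F) (hT₀ : 0 < T₀)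
    (hR₀ : 0 < R₀) (hρ₀ : 0 < ρ₀) {m : ℝ → ℝ} (hm : IsWeight T₀ m) {A B μ d : ℝ} (hA : 0 < A)
    (hB : 0 < B) (ha : ∀ t ∈ Icc 0 T₀, ∀ x ∈ ball (0 : ℂ) R₀, ‖coeffA F t x‖ ≤ A * t ^ μ)
    (hb : ∀ t ∈ Ioc 0 T₀, ∀ x ∈ ball (0 : ℂ) R₀, ‖coeffB F t x‖ ≤ B * m t)
    (hd0 : 0 < d) (hd : (coeffLambda F 0 0).re < d) (hdμ : d < μ) {δ : ℝ} (hδ : 0 < δ) :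
    ∃ R T C η : ℝ, ∃ W Ψ : ℝ → ℝ, 0 < R ∧ R ≤ 1 ∧ R ≤ R₀ ∧ R ≤ δ ∧ 0 < T ∧ T ≤ 1 ∧ T ≤ T₀ ∧
      T ≤ δ ∧ IsContractive F (coeffLambda F 0 0) T R ρ₀ d η C W ∧ IsShrinkage T W Ψ ∧ 0 ≤ η ∧
      η ≤ (d - (coeffLambda F 0 0).re) * (R / 128) ∧ ∀ t ∈ Ioo 0 T, Ψ t ≤ R / 4 := by
  set lam := coeffLambda F 0 0 with hlam
  have hgap : 0 < d - lam.re := by linarith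
  obtain ⟨K, hK0, hK⟩ := hF.exists_norm_deriv_snd_le hR₀ hρ₀
  obtain ⟨ε, hε, hlin⟩ := hF.exists_norm_deriv_fst_sub_le hT₀ hR₀ hρ₀
    (show 0 < (d - lam.re) / 16 by positivity)
  obtain ⟨Ψ, hΨ, hΨ0⟩ := hm.exists_shrinkage (c₁ := 64 * B) (c₂ := 128 * K) hT₀ (by positivity)
    (by positivity) hd0
  set R := min (min 1 (R₀ / 2)) (min δ ε) with hR
  have hR0 : 0 < R := by positivity
  have hR1 : R ≤ 1 := (min_le_left _ _).trans (min_le_left _ _)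
  have hR2 : R ≤ R₀ / 2 := (min_le_left _ _).trans (min_le_right _ _)
  have hR3 : R ≤ δ := (min_le_right _ _).trans (min_le_left _ _)
  have hR4 : R ≤ ε := (min_le_right _ _).trans (min_le_right _ _)
  have hpow : ∀ {c : ℝ}, 0 < c → Tendsto (fun t : ℝ => t ^ c) (𝓝[>] 0) (𝓝 0) := by
    intro c hc
    have := (Real.continuousAt_rpow_const 0 c (Or.inr hc.le)).tendsto
    rw [Real.zero_rpow hc.ne'] at this
    exact this.mono_left nhdsWithin_le_nhds
  have hid : Tendsto (fun t : ℝ => t) (𝓝[>] 0) (𝓝 0) := tendsto_id.mono_left nhdsWithin_le_nhds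
  have hη : Tendsto (fun t : ℝ => A * t ^ (μ - d)) (𝓝[>] 0) (𝓝 0) := by
    simpa using (hpow (sub_pos.2 hdμ)).const_mul A
  have hev : ∀ᶠ T in 𝓝[>] (0 : ℝ), 0 < T ∧ T < min (min 1 T₀) (min δ ε) ∧
      T ^ d < min (ρ₀ / 4) ε ∧ A * T ^ (μ - d) < (d - lam.re) * (R / 128) ∧ Ψ T < R / 4 :=
    (eventually_mem_nhdsWithin).and <| (hid.eventually (gt_mem_nhds (by positivity))).and <|
      ((hpow hd0).eventually (gt_mem_nhds (by positivity))).and <|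
      (hη.eventually (gt_mem_nhds (by positivity))).and
      (hΨ0.eventually (gt_mem_nhds (by positivity)))
  obtain ⟨T, hT, hTmin, hTd, hTη, hTΨ⟩ := hev.exists
  have hT1 : T < 1 := hTmin.trans_le ((min_le_left _ _).trans (min_le_left _ _))
  have hT2 : T < T₀ := hTmin.trans_le ((min_le_left _ _).trans (min_le_right _ _))
  have hT3 : T < δ := hTmin.trans_le ((min_le_right _ _).trans (min_le_left _ _))
  have hT4 : T < ε := hTmin.trans_le ((min_le_right _ _).trans (min_le_right _ _))
  have hTd1 : T ^ d < ρ₀ / 4 := hTd.trans_le (min_le_left _ _)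
  have hTd2 : T ^ d < ε := hTd.trans_le (min_le_right _ _)
  have htle : ∀ t ∈ Ioo 0 T, t ^ d ≤ T ^ d := fun t ht => Real.rpow_le_rpow ht.1.le ht.2.le hd0.le
  have hsub : ∀ t ∈ Ioo 0 T, t ∈ Icc 0 T₀ := fun t ht => ⟨ht.1.le, (ht.2.trans hT2).le⟩
  have hRR : ∀ x ∈ ball (0 : ℂ) R, x ∈ ball (0 : ℂ) R₀ := fun x hx =>
    ball_subset_ball (by linarith) hx
  refine ⟨R, T, 64 * B * m T₀ + 128 * K * T ^ d, A * T ^ (μ - d),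
    fun t => 64 * B * m t + 128 * K * t ^ d, Ψ, hR0, hR1, by linarith, hR3, hT, hT1.le, hT2.le,
    hT3.le, ?_, hΨ.mono hT2.le, by positivity, hTη.le, fun t ht => ?_⟩
  · refine ⟨hd, ?_, ?_, ?_, ?_, ?_, ?_, ?_⟩
    · exact hF.continuousOn.mono (prod_mono (fun t ht => hsub t ht)
        (prod_mono_left fun x hx => hRR x hx))
    · exact fun t ht => (hF.holomorphic t (hsub t ht)).mono (prod_mono_left fun x hx => hRR x hx)
    · intro t ht
      linarith [htle t ht]
    · intro t ht x hx
      refine (ha t (hsub t ht) x (hRR x hx)).trans ?_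
      rw [show μ = (μ - d) + d by ring, Real.rpow_add ht.1, ← mul_assoc, add_sub_cancel_right]
      have := Real.rpow_nonneg ht.1.le d
      have := Real.rpow_le_rpow ht.1.le ht.2.le (sub_pos.2 hdμ).le
      gcongr
    · intro t ht x hx z₁ z₂ w₁ w₂ hz₁ hz₂ hw₁ hw₂
      have hxR : ‖x‖ < R := by simpa using hx
      have hte := htle t ht
      refine hF.norm_sub_sub_le (hsub t ht) (by linarith) (e := t ^ d) (by linarith) ?_ ?_
        hz₁ hz₂ hw₁ hw₂
      · intro z w hz hw
        exact hlin t (hsub t ht) x z w (by linarith) (by linarith) (by linarith)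
          (ht.2.trans hT4) (by linarith) (by linarith) (by linarith)
      · intro z w hz hw
        refine (hK t (hsub t ht) x z w (by linarith) (by linarith) (by linarith)).trans ?_
        have h1 := hb t ⟨ht.1, (hsub t ht).2⟩ x (hRR x hx)
        calc _ ≤ B * m t + K * (t ^ d + t ^ d) := by gcongr
          _ = _ := by ring
    · exact fun t ht => hΨ.nonneg t ⟨ht.1, ht.2.trans hT2⟩
    · intro t ht
      have h1 := hm.monotoneOn ⟨ht.1, (hsub t ht).2⟩ ⟨hT₀, le_rfl⟩ (hsub t ht).2
      have h2 := htle t ht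
      gcongr
  · exact (hΨ.le_of_le ht.1.le ht.2.le hT2).trans hTΨ.le

end

/-! ### Germs of solutions -/

section

variable {T₀ R₀ ρ₀ T R C d : ℝ} {F : ℝ → ℂ × ℂ × ℂ → ℂ}

lemma coeff_add_remainder (t : ℝ) (x z₁ z₂ : ℂ) :
    coeffA F t x + coeffLambda F t x * z₁ + coeffB F t x * z₂ + remainder F t x z₁ z₂ =
      F t (x, z₁, z₂) := by
  rw [remainder]; ring

/-- The extension by `0` to `t ≤ 0`. -/
noncomputable def extendZero (f : ℝ → ℂ → ℂ) (p : ℝ × ℂ) : ℂ := if p.1 ≤ 0 then 0 else f p.1 p.2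

lemma extendZero_of_pos {f : ℝ → ℂ → ℂ} {t : ℝ} (ht : 0 < t) (x : ℂ) :
    extendZero f (t, x) = f t x := if_neg ht.not_ge

lemma extendZero_zero {f : ℝ → ℂ → ℂ} (x : ℂ) : extendZero f (0, x) = 0 := if_pos le_rfl

/-- Decay as `t → 0` makes the extension by `0` continuous up to `t = 0`. -/
lemma extendZero_mem_X0 {f : ℝ → ℂ → ℂ} {T' : ℝ} (hd : 0 < d) (hT : T' < T)
    (hf : HolomorphicIn (Ioo 0 T ×ˢ ball 0 R) f)
    (hC : ∀ t ∈ Ioo 0 T, ∀ x ∈ ball (0 : ℂ) R, ‖f t x‖ ≤ C * t ^ d) :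
    extendZero f ∈ X0 T' R := by
  have hopen : IsOpen (Ioo 0 T ×ˢ ball (0 : ℂ) R) := isOpen_Ioo.prod isOpen_ball
  refine ⟨?_, ?_⟩
  · rintro ⟨t, x⟩ ⟨ht, hx⟩
    have ht : t ∈ Icc 0 T' := ht
    have hx : x ∈ ball (0 : ℂ) R := hx
    rcases ht.1.eq_or_lt with rfl | hpos
    · rw [ContinuousWithinAt, extendZero_zero]
      have hlim : Tendsto (fun p : ℝ × ℂ => C * p.1 ^ d) (𝓝[Icc 0 T' ×ˢ ball 0 R] (0, x))
          (𝓝 0) := by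
        have h1 : ContinuousAt (fun p : ℝ × ℂ => C * p.1 ^ d) (0, x) :=
          continuousAt_const.mul ((Real.continuousAt_rpow_const (0 : ℝ) d (Or.inr hd.le)).comp
            (f := fun p : ℝ × ℂ => p.1) (x := ((0 : ℝ), x)) continuousAt_fst)
        have h2 := h1.tendsto
        simp only [Real.zero_rpow hd.ne', mul_zero] at h2
        exact h2.mono_left nhdsWithin_le_nhds
      refine squeeze_zero_norm' ?_ hlim
      filter_upwards [self_mem_nhdsWithin] with p hp
      obtain ⟨s, y⟩ := p
      have hs : s ∈ Icc 0 T' := hp.1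
      rcases hs.1.eq_or_lt with rfl | hs0
      · rw [extendZero_zero, norm_zero, Real.zero_rpow hd.ne', mul_zero]
      · rw [extendZero_of_pos hs0]
        exact hC s ⟨hs0, hs.2.trans_lt hT⟩ y hp.2
    · have hmem : (t, x) ∈ Ioo 0 T ×ˢ ball (0 : ℂ) R := ⟨⟨hpos, ht.2.trans_lt hT⟩, hx⟩
      refine ((hf.1.continuousAt (hopen.mem_nhds hmem)).congr ?_).continuousWithinAt
      filter_upwards [hopen.mem_nhds hmem] with p hp
      exact (extendZero_of_pos hp.1.1 p.2).symm
  · intro t ht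
    rcases ht.1.eq_or_lt with rfl | hpos
    · simp only [extendZero_zero]
      exact differentiableOn_const _
    · simp only [extendZero_of_pos hpos]
      exact fun x hx => (hf.2 (t, x) ⟨⟨hpos, ht.2.trans_lt hT⟩, hx⟩).differentiableWithinAt

lemma X0_mono {T' : ℝ} (hT : T' ≤ T) : X0 T R ⊆ X0 T' R := fun _ hf =>
  ⟨hf.1.mono (prod_mono_left (Icc_subset_Icc_right hT)),
    fun t ht => hf.2 t (Icc_subset_Icc_right hT ht)⟩

lemma X1_mono {T' : ℝ} (hT : T' ≤ T) : X1 T R ⊆ X1 T' R := by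
  rintro u ⟨h0, h1, w, hw, h⟩
  exact ⟨X0_mono hT h0, h1.mono (prod_mono_left (Ioo_subset_Ioo_right hT)), w, X0_mono hT hw,
    fun t ht => h t (Ioo_subset_Ioo_right hT ht)⟩

lemma X1germ_anti {a : ℝ} (ha : 0 ≤ a) (had : a ≤ d) : X1germ d ⊆ X1germ a := by
  rintro g ⟨T, hT, R, hR, u, ⟨hu, C, hC, hb⟩, rfl⟩
  refine ⟨min T 1, by positivity, R, hR, u, ⟨X1_mono (min_le_left _ _) hu, C, hC,
    fun t ht x hx => (hb t ⟨ht.1, ht.2.trans (min_le_left _ _)⟩ x hx).trans ?_⟩, rfl⟩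
  have := Real.rpow_le_rpow_of_exponent_ge' ht.1 (ht.2.trans (min_le_right _ _)) ha had
  gcongr

lemma toGerm_eq_of_eqOn {u v : ℝ × ℂ → ℂ} (hT : 0 < T) (hR : 0 < R)
    (h : ∀ t ∈ Ico 0 T, ∀ x ∈ ball (0 : ℂ) R, u (t, x) = v (t, x)) : toGerm u = toGerm v := by
  refine Germ.coe_eq.2 ?_
  filter_upwards [prod_mem_prod (Ico_mem_nhdsGE hT) (ball_mem_nhds (0 : ℂ) hR)] with p hp
    using h p.1 hp.1 p.2 hp.2

/-- A representative of a germ in `X₁^{d'}` is bounded by `t^d`, without a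
constant, if `d < d'`. -/
lemma exists_le_rpow_of_mem_X1germ {d' : ℝ} (hd : 0 < d) (hdd : d < d') {u : ℝ × ℂ → ℂ}
    (hu : toGerm u ∈ X1germ d') : ∃ δ > 0, ∀ t ∈ Ico 0 δ, ∀ x ∈ ball (0 : ℂ) δ,
      ‖u (t, x)‖ ≤ t ^ d ∧ ‖deriv (fun y => u (t, y)) x‖ ≤ t ^ d := by
  obtain ⟨T, hT, R, hR, v, ⟨-, C, hC, hb⟩, hvu⟩ := hu
  have hev : (v : ℝ × ℂ → ℂ) =ᶠ[𝓝[≥] (0 : ℝ) ×ˢ 𝓝 (0 : ℂ)] u := Germ.coe_eq.1 hvu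
  obtain ⟨s, hs, s', hs', hss⟩ := Filter.mem_prod_iff.1 hev
  obtain ⟨ε₁, hε₁, h₁⟩ := (mem_nhdsGE_iff_exists_Ico_subset).1 hs
  obtain ⟨ε₂, hε₂, h₂⟩ := Metric.mem_nhds_iff.1 hs'
  have hlim : Tendsto (fun t : ℝ => C * t ^ (d' - d)) (𝓝 0) (𝓝 0) := by
    have := ((Real.continuousAt_rpow_const 0 (d' - d) (Or.inr (by linarith))).const_mul C).tendsto
    rwa [Real.zero_rpow (by linarith), mul_zero] at this
  obtain ⟨ε₃, hε₃, h₃⟩ := Metric.eventually_nhds_iff.1 (hlim.eventually (gt_mem_nhds one_pos))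
  have hε₁ : 0 < ε₁ := hε₁
  refine ⟨min (min T R) (min ε₁ (min ε₂ ε₃)), by positivity, fun t ht x hx => ?_⟩
  have hx : ‖x‖ < min (min T R) (min ε₁ (min ε₂ ε₃)) := by simpa using hx
  simp only [mem_Ico, lt_min_iff] at ht hx
  have heq : ∀ y : ℂ, ‖y‖ < ε₂ → v (t, y) = u (t, y) := fun y hy =>
    hss (mk_mem_prod (h₁ ⟨ht.1, ht.2.2.1⟩) (h₂ (by simpa using hy)))
  have heq' : (fun y => v (t, y)) =ᶠ[𝓝 x] fun y => u (t, y) := by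
    filter_upwards [isOpen_ball.mem_nhds (show x ∈ ball (0 : ℂ) ε₂ by simpa using hx.2.2.1)]
      with y hy using heq y (by simpa using hy)
  have hle : C * t ^ d' ≤ t ^ d := by
    rcases ht.1.eq_or_lt with rfl | hpos
    · rw [Real.zero_rpow (by linarith), Real.zero_rpow hd.ne', mul_zero]
    · have h4 := (h₃ (y := t) (by
        rw [Real.dist_eq, sub_zero, abs_of_pos hpos]
        exact ht.2.2.2.2)).le
      have htd := Real.rpow_nonneg hpos.le d
      calc C * t ^ d' = C * t ^ (d' - d) * t ^ d := by
            rw [mul_assoc, ← Real.rpow_add hpos, sub_add_cancel]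
        _ ≤ _ := mul_le_of_le_one_left htd h4
  have hfin := (hb t ⟨ht.1, ht.2.1.1.le⟩ x (by simpa using hx.1.2)).trans hle
  rw [← heq x hx.2.2.1, ← heq'.deriv_eq]
  exact ⟨(le_max_left _ _).trans hfin, (le_max_right _ _).trans hfin⟩

namespace IsSolutionOn

variable {u : ℝ × ℂ → ℂ}

lemma hasDerivAt (hu : IsSolutionOn T₀ R₀ ρ₀ F T R u) {t : ℝ} (ht : t ∈ Ioo 0 T) {x : ℂ}
    (hx : x ∈ ball (0 : ℂ) R) : HasDerivAt (fun s => u (s, x))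
      (F t (x, u (t, x), deriv (fun y => u (t, y)) x) / t) t := by
  have hopen : IsOpen (Ioo 0 T ×ˢ ball (0 : ℂ) R) := isOpen_Ioo.prod isOpen_ball
  have h1 : DifferentiableAt ℝ u (t, x) :=
    (hu.regular.2.1.differentiableOn one_ne_zero).differentiableAt (hopen.mem_nhds ⟨ht, hx⟩)
  have h2 : DifferentiableAt ℝ (fun s : ℝ => u (s, x)) t :=
    h1.comp (f := fun s : ℝ => (s, x)) t (by fun_prop)
  have h3 := hu.equation t ht x hx
  rw [coeff_add_remainder] at h3
  have ht' : (t : ℂ) ≠ 0 := by exact_mod_cast ht.1.ne'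
  rw [← h3, mul_div_cancel_left₀ _ ht']
  exact h2.hasDerivAt

/-- A solution of size `t^d` near the origin is small on every small cone. -/
lemma isSmall (hu : IsSolutionOn T₀ R₀ ρ₀ F T R u) {Ω : Set (ℝ × ℂ)} {δ : ℝ}
    (h : ∀ t ∈ Ico 0 δ, ∀ x ∈ ball (0 : ℂ) δ,
      ‖u (t, x)‖ ≤ t ^ d ∧ ‖deriv (fun y => u (t, y)) x‖ ≤ t ^ d)
    (hΩ : ∀ p ∈ Ω, p.1 ∈ Ioo 0 T ∧ p.1 < δ ∧ ‖p.2‖ < R ∧ ‖p.2‖ < δ) :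
    IsSmall Ω d (fun t x => u (t, x)) := by
  have hmem : ∀ p ∈ Ω, p.1 ∈ Icc 0 T ∧ p.2 ∈ ball (0 : ℂ) R := fun p hp =>
    ⟨Ioo_subset_Icc_self (hΩ p hp).1, by simpa using (hΩ p hp).2.2.1⟩
  have hb : ∀ p ∈ Ω, ‖u (p.1, p.2)‖ ≤ p.1 ^ d ∧ ‖deriv (fun y => u (p.1, y)) p.2‖ ≤ p.1 ^ d :=
    fun p hp => h p.1 ⟨(hΩ p hp).1.1.le, (hΩ p hp).2.1⟩ p.2 (by simpa using (hΩ p hp).2.2.2)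
  refine ⟨⟨hu.regular.1.1.mono fun p hp => hmem p hp, fun p hp => ?_⟩,
    fun p hp => (hb p hp).1, fun p hp => (hb p hp).2⟩
  exact (hu.regular.1.2 p.1 (hmem p hp).1).differentiableAt (isOpen_ball.mem_nhds (hmem p hp).2)

end IsSolutionOn

section

variable (hT₀ : 0 < T₀) (hR₀ : 0 < R₀) (hρ₀ : 0 < ρ₀) (hF : IsAdmissible T₀ R₀ ρ₀ F)
  {m : ℝ → ℝ} (hm : IsWeight T₀ m) {A B μ : ℝ} (hA : 0 < A) (hB : 0 < B)
  (ha : ∀ t ∈ Icc 0 T₀, ∀ x ∈ ball (0 : ℂ) R₀, ‖coeffA F t x‖ ≤ A * t ^ μ)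
  (hb : ∀ t ∈ Ioc 0 T₀, ∀ x ∈ ball (0 : ℂ) R₀, ‖coeffB F t x‖ ≤ B * m t)
  (hpos : 0 < (coeffLambda F 0 0).re)
include hT₀ hR₀ hρ₀ hF hm hA hB ha hb hpos

/-- Solutions that decay faster than `t^{Re λ(0,0)}` are unique. -/
lemma solutionGerms_unique (hd : (coeffLambda F 0 0).re < d) (hdμ : d ≤ μ) {g₁ g₂ : FunGerm}
    (h₁ : g₁ ∈ X1germ d) (h₂ : g₂ ∈ X1germ d) (hs₁ : g₁ ∈ solutionGerms T₀ R₀ ρ₀ F)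
    (hs₂ : g₂ ∈ solutionGerms T₀ R₀ ρ₀ F) : g₁ = g₂ := by
  obtain ⟨T₁, hT₁, R₁, hR₁, u, hu, rfl⟩ := hs₁
  obtain ⟨T₂, hT₂, R₂, hR₂, v, hv, rfl⟩ := hs₂
  -- a smaller exponent absorbs the constants in the bounds of the two solutions
  obtain ⟨d', hd', hdd⟩ := exists_between hd
  have hd0 : 0 < d' := hpos.trans hd'
  obtain ⟨δ₁, hδ₁, hb₁⟩ := exists_le_rpow_of_mem_X1germ hd0 hdd h₁
  obtain ⟨δ₂, hδ₂, hb₂⟩ := exists_le_rpow_of_mem_X1germ hd0 hdd h₂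
  have hδ : 0 < min (min T₁ R₁) (min (min T₂ R₂) (min δ₁ δ₂)) := by positivity
  obtain ⟨R, T, C, η, W, Ψ, hR, -, -, hRδ, hT, -, -, hTδ, hC, hW, -, -, hΨ⟩ :=
    hF.exists_isContractive hT₀ hR₀ hρ₀ hm hA hB ha hb hd0 hd' (hdd.trans_le hdμ) hδ
  simp only [le_min_iff] at hRδ hTδ
  have hcone : ∀ p ∈ cone T Ψ R, p.1 ∈ Ioo 0 T ∧ ‖p.2‖ < R := hW.cone_bounds le_rfl
  have hsu := hu.isSmall hb₁ (Ω := cone T Ψ R) fun p hp => by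
    obtain ⟨a, b⟩ := hcone p hp
    exact ⟨⟨a.1, by linarith [a.2]⟩, by linarith [a.2], by linarith, by linarith⟩
  have hsv := hv.isSmall hb₂ (Ω := cone T Ψ R) fun p hp => by
    obtain ⟨a, b⟩ := hcone p hp
    exact ⟨⟨a.1, by linarith [a.2]⟩, by linarith [a.2], by linarith, by linarith⟩
  have heq := hC.eq_of_solutions hW le_rfl hsu hsv
    (fun p hp => by
      obtain ⟨a, b⟩ := hcone p hp
      exact hu.hasDerivAt ⟨a.1, by linarith [a.2]⟩ (by simp; linarith))
    (fun p hp => by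
      obtain ⟨a, b⟩ := hcone p hp
      exact hv.hasDerivAt ⟨a.1, by linarith [a.2]⟩ (by simp; linarith))
  refine toGerm_eq_of_eqOn hT (half_pos hR) fun t ht x hx => ?_
  have hx : ‖x‖ < R / 2 := by simpa using hx
  rcases ht.1.eq_or_lt with rfl | hpos
  · have e₁ := (hb₁ 0 ⟨le_rfl, hδ₁⟩ x (by simp; linarith)).1
    have e₂ := (hb₂ 0 ⟨le_rfl, hδ₂⟩ x (by simp; linarith)).1
    rw [Real.zero_rpow hd0.ne'] at e₁ e₂
    rw [norm_le_zero_iff.1 e₁, norm_le_zero_iff.1 e₂]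
  · refine heq (t, x) ⟨⟨hpos, ht.2⟩, ?_⟩
    have := hΨ t ⟨hpos, ht.2⟩
    simp only
    linarith

/-- There is a solution of size `t^d` for every `d` between `Re λ(0,0)` and `μ`. -/
lemma exists_solutionGerm (hd : (coeffLambda F 0 0).re < d) (hdμ : d < μ) :
    ∃ g ∈ X1germ d, g ∈ solutionGerms T₀ R₀ ρ₀ F := by
  have hd0 : 0 < d := hpos.trans hd
  obtain ⟨R, T, C, η, W, Ψ, hR, hR1, hRR₀, -, hT, -, hTT₀, -, hC, hW, hη, hηR, hΨ⟩ :=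
    hF.exists_isContractive hT₀ hR₀ hρ₀ hm hA hB ha hb hd0 hd hdμ one_pos
  obtain ⟨u, hu, hsol⟩ := hC.exists_solution hW hT hR hR1 hη hηR
  have hRle : R / 2 ≤ R := by linarith
  have hsub : Ioo 0 T ×ˢ ball (0 : ℂ) (R / 4) ⊆ cone T Ψ (R / 2) := by
    rintro p ⟨hp1, hp2⟩
    have h1 := hΨ p.1 hp1
    have h2 : ‖p.2‖ < R / 4 := by simpa using hp2
    exact ⟨hp1, by linarith⟩
  have hΩ : IsOpen (Ioo 0 T ×ˢ ball (0 : ℂ) (R / 4)) := isOpen_Ioo.prod isOpen_ball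
  have hu' := hu.mono hsub
  -- the values `F(t, x, u, u_x)` of `t ∂u/∂t`
  set G : ℝ → ℂ → ℂ := fun t x => F t (x, u t x, deriv (u t) x) with hG
  have hbd : ∀ p ∈ Ioo 0 T ×ˢ ball (0 : ℂ) (R / 4), p.1 ∈ Ioo 0 T ∧ ‖p.2‖ < R := fun p hp =>
    hW.cone_bounds hRle p (hsub hp)
  have hGs : ∀ t x, G t x = source F (coeffLambda F 0 0) u t x + coeffLambda F 0 0 * u t x := by
    intro t x
    rw [hG, source]
    ring
  have hsrc := hC.holomorphicIn_source hΩ hbd hu'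
  have hGhol : HolomorphicIn (Ioo 0 T ×ˢ ball (0 : ℂ) (R / 4)) G := by
    rw [show G = fun t x => source F (coeffLambda F 0 0) u t x + coeffLambda F 0 0 * u t x from
      funext fun t => funext fun x => hGs t x]
    exact ⟨hsrc.1.add (continuousOn_const.mul hu'.1.1),
      fun p hp => (hsrc.2 p hp).add ((hu'.1.2 p hp).const_mul _)⟩
  have hGbd : ∀ t ∈ Ioo 0 T, ∀ x ∈ ball (0 : ℂ) (R / 4), ‖G t x‖ ≤
      (η + (d - (coeffLambda F 0 0).re) / 16 + C / 64 + ‖coeffLambda F 0 0‖) * t ^ d := by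
    intro t ht x hx
    rw [hGs, add_mul]
    refine (norm_add_le _ _).trans (add_le_add
      (hC.norm_source_le hbd hu' (t, x) ⟨ht, hx⟩) ?_)
    rw [norm_mul]
    gcongr
    exact hu'.2 (t, x) ⟨ht, hx⟩
  have hder : ∀ p ∈ Ioo 0 T ×ˢ ball (0 : ℂ) (R / 4),
      HasDerivAt (fun s => u s p.2) (G p.1 p.2 / p.1) p.1 := fun p hp => hsol p (hsub hp)
  have hC1 : ContDiffOn ℝ 1 (fun p : ℝ × ℂ => u p.1 p.2) (Ioo 0 T ×ˢ ball (0 : ℂ) (R / 4)) := by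
    refine hu'.1.contDiffOn (f' := fun t x => G t x / t) hΩ (hGhol.1.div ?_ ?_) hder
    · exact (Complex.continuous_ofReal.comp continuous_fst).continuousOn
    · intro p hp
      exact_mod_cast hp.1.1.ne'
  have hext : ∀ t : ℝ, 0 < t → (fun y => extendZero u (t, y)) = u t := fun t ht =>
    funext fun y => extendZero_of_pos ht y
  have hTT : T / 2 < T := by linarith
  have hIoo : Ioo 0 (T / 2) ⊆ Ioo 0 T := Ioo_subset_Ioo_right hTT.le
  have htime : ∀ t ∈ Ioo 0 (T / 2), ∀ x ∈ ball (0 : ℂ) (R / 4),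
      (t : ℂ) * deriv (fun s : ℝ => extendZero u (s, x)) t = G t x := by
    intro t ht x hx
    have h1 : (fun s : ℝ => extendZero u (s, x)) =ᶠ[𝓝 t] fun s => u s x := by
      filter_upwards [lt_mem_nhds ht.1] with s hs using extendZero_of_pos hs x
    have ht' : (t : ℂ) ≠ 0 := by exact_mod_cast ht.1.ne'
    rw [h1.deriv_eq, (hder (t, x) ⟨hIoo ht, hx⟩).deriv]
    field_simp
  have hX1 : extendZero u ∈ X1 (T / 2) (R / 4) := by
    refine ⟨extendZero_mem_X0 (C := 1) hd0 hTT hu'.1 (fun t ht x hx => by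
      simpa using hu'.2 (t, x) ⟨ht, hx⟩), ?_, extendZero G,
      extendZero_mem_X0 hd0 hTT hGhol hGbd, fun t ht x hx => ?_⟩
    · exact (hC1.mono (prod_mono_left hIoo)).congr fun p hp => extendZero_of_pos hp.1.1 p.2
    · rw [htime t ht x hx, extendZero_of_pos ht.1]
  refine ⟨toGerm (extendZero u), ⟨T / 2, half_pos hT, R / 4, by positivity, extendZero u,
    ⟨hX1, 1, one_pos, fun t ht x hx => ?_⟩, rfl⟩,
    ⟨T / 2, half_pos hT, R / 4, by positivity, extendZero u, ⟨by linarith, by linarith, hX1,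
      fun t ht x hx => ?_, fun t ht x hx => ?_⟩, rfl⟩⟩
  · rcases ht.1.eq_or_lt with rfl | ht0
    · simp [extendZero_zero, Real.zero_rpow hd0.ne']
    · have hp : (t, x) ∈ Ioo 0 T ×ˢ ball (0 : ℂ) (R / 4) := ⟨⟨ht0, ht.2.trans_lt hTT⟩, hx⟩
      rw [hext t ht0, extendZero_of_pos ht0, one_mul]
      exact max_le (hu'.2 _ hp) (hu'.3 _ hp)
  · have h := hC.source_arg_mem hbd hu' (p := (t, x)) ⟨hIoo ht, hx⟩
    rw [hext t ht.1, extendZero_of_pos ht.1]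
    exact h.2
  · rw [coeff_add_remainder, htime t ht x hx, hext t ht.1, extendZero_of_pos ht.1]

end

end

end BriotBouquet

theorem theorem3p1 (T₀ R₀ ρ₀ : ℝ) (hT₀ : 0 < T₀) (hR₀ : 0 < R₀) (hρ₀ : 0 < ρ₀)
    (F : ℝ → ℂ × ℂ × ℂ → ℂ) (hF : BriotBouquet.IsAdmissible T₀ R₀ ρ₀ F)
    (m : ℝ → ℝ) (hm : BriotBouquet.IsWeight T₀ m)
    (A B μ : ℝ) (hA : 0 < A) (hB : 0 < B)
    (ha : ∀ t ∈ Set.Icc 0 T₀, ∀ x ∈ Metric.ball (0 : ℂ) R₀,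
      ‖BriotBouquet.coeffA F t x‖ ≤ A * t ^ μ)
    (hb : ∀ t ∈ Set.Ioc 0 T₀, ∀ x ∈ Metric.ball (0 : ℂ) R₀,
      ‖BriotBouquet.coeffB F t x‖ ≤ B * m t)
    (hpos : 0 < (BriotBouquet.coeffLambda F 0 0).re)
    (hlt : (BriotBouquet.coeffLambda F 0 0).re < μ) :
    ∃! g : BriotBouquet.FunGerm,
      g ∈ BriotBouquet.X1paren μ ∧ g ∈ BriotBouquet.solutionGerms T₀ R₀ ρ₀ F := by
  obtain ⟨d, hd, hdμ⟩ := exists_between hlt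
  have hd0 : 0 < d := hpos.trans hd
  have hex : ∀ c, d ≤ c → c < μ → ∃ g ∈ BriotBouquet.X1germ c,
      g ∈ BriotBouquet.solutionGerms T₀ R₀ ρ₀ F := fun c hdc hcμ =>
    BriotBouquet.exists_solutionGerm hT₀ hR₀ hρ₀ hF hm hA hB ha hb hpos (hd.trans_le hdc) hcμ
  obtain ⟨g, hg, hgs⟩ := hex d le_rfl hdμ
  have huniq : ∀ g' ∈ BriotBouquet.X1germ d, g' ∈ BriotBouquet.solutionGerms T₀ R₀ ρ₀ F →
      g' = g := fun g' h hs =>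
    BriotBouquet.solutionGerms_unique hT₀ hR₀ hρ₀ hF hm hA hB ha hb hpos hd hdμ.le h hg hs hgs
  refine ⟨g, ⟨?_, hgs⟩, fun g' hg' => huniq g' ?_ hg'.2⟩
  · refine mem_iInter₂.2 fun a ha => ?_
    -- the solution of size `t^c` with `c = max a d` is the germ `g`
    obtain ⟨g', hg', hgs'⟩ := hex (max a d) (le_max_right _ _) (max_lt ha.2 hdμ)
    rw [← huniq g' (BriotBouquet.X1germ_anti hd0.le (le_max_right _ _) hg') hgs']
    exact BriotBouquet.X1germ_anti ha.1.le (le_max_left _ _) hg'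
  · exact mem_iInter₂.1 hg'.1 d ⟨hd0, hdμ⟩
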